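/- Notation. Let $n\ge 1$. For an increasing (nondecreasing) $\Phi:[0,\infty]\to[0,\infty]$ put $a(\Phi)=\sup\{t\ge0:\Phi(t)=0\}$ and $b(\Phi)=\inf\{t\ge0:\Phi(t)=\infty\}$ ($\sup\emptyset=0$, $\inf\emptyset=\infty$). Let $\overline{\mathbf\Phi}$ be the set of all increasing $\Phi$ such that $a(\Phi)<\infty$, $b(\Phi)>0$, $\lim_{t\to+0}\Phi(t)=\Phi(0)=0$, $\Phi$ is left continuous on $[0,b(\Phi))$, $\lim_{t\to\infty}\Phi(t)=\Phi(\infty)=\infty$ if $b(\Phi)=\infty$, and $\lim_{t\to b(\Phi)-0}\Phi(t)=\Phi(b(\Phi))$ if $b(\Phi)<\infty$. A Young function is a $\Phi\in\overline{\mathbf\Phi}$ that is convex on $[0,b(\Phi))$. Let $\overline{\mathbf\Phi}_Y$ be the set of all $\Phi\in\overline{\mathbf\Phi}$ for which there are a Young function $\Phi_1$ and a constant $C>0$ with $\Phi(t/C)\le\Phi_1(t)\le\Phi(Ct)$ for all $t\in[0,\infty]$. Put $\Phi^{-1}(u)=\inf\{t\ge0:\Phi(t)>u\}$ for $u\in[0,\infty)$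 and $\Phi^{-1}(\infty)=\infty$. We say $\Phi\in\overline\nabla_2$ if for some $k>1$ one has $\Phi(t)\le\frac1{2k}\Phi(kt)$ for all $t>0$. For $\Phi\in\overline{\mathbf\Phi}_Y$, $L^\Phi(\mathbb R^n)$ is the set of measurable $f$ with $\int\Phi(\epsilon|f|)\,dx<\infty$ for some $\epsilon>0$, and $\|f\|_{L^\Phi}=\inf\{\lambda>0:\int\Phi(|f|/\lambda)\,dx\le1\}$; $\mathrm wL^\Phi(\mathbb R^n)$ is the set of measurable $f$ with $\sup_{0<t<\infty}\Phi(t)\,m(\epsilon f,t)<\infty$ for some $\epsilon>0$, and $\|f\|_{\mathrm wL^\Phi}=\inf\{\lambda>0:\sup_{0<t<\infty}\Phi(t)\,m(f/\lambda,t)\le1\}$, where $m(f,t)=|\{x:|f(x)|>t\}|$. Functions are complex valued, or $[0,\infty]$-valued and finite almost everywhere. For $\rho:(0,\infty)\to(0,\infty)$ let $$M_\rho f(x)=\sup_{B(z,r)\ni x}\rho(r)\frac1{|B(z,r)|}\int_{B(z,r)}|f(y)|\,dy,$$ the supremum being over all open balls containing $x$, and let $M$ be the case $\rho\equiv1$ (the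 Hardy-Littlewood maximal operator). $M_\rho$ is bounded from $L^\Phi$ to $L^\Psi$ (resp. $\mathrm wL^\Psi$) if there is $C>0$ such that for all $f\in L^\Phi(\mathbb R^n)$ one has $M_\rho f\in L^\Psi(\mathbb R^n)$ and $\|M_\rho f\|_{L^\Psi}\le C\|f\|_{L^\Phi}$ (resp. the same with $\mathrm wL^\Psi$). Theorem. Let $n\ge1$, let $\rho:(0,\infty)\to(0,\infty)$ be an arbitrary function, and let $\Phi,\Psi\in\overline{\mathbf\Phi}_Y$. (i) Assume that there is a constant $A>0$ such that, for all $r\in(0,\infty)$, $$\Big(\sup_{0<t\le r}\rho(t)\Big)\Phi^{-1}(1/r^n)\le A\,\Psi^{-1}(1/r^n).\qquad(*)$$ Then for every constant $C_0>0$ there is a constant $C_1>0$ such that, for all $f\in L^\Phi(\mathbb R^n)$ that do not vanish almost everywhere and all $x\in\mathbb R^n$, $$\Psi\Big(\frac{M_\rho f(x)}{C_1\|f\|_{L^\Phi}}\Big)\le\Phi\Big(\frac{Mf(x)}{C_0\|f\|_{L^\Phi}}\Big).$$ Moreover, $M_\rho$ is bounded from $L^\Phi(\mathbb R^n)$ to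 $\mathrm wL^\Psi(\mathbb R^n)$; and if $\Phi\in\overline\nabla_2$, then $M_\rho$ is bounded from $L^\Phi(\mathbb R^n)$ to $L^\Psi(\mathbb R^n)$. (ii) Conversely, if $M_\rho$ is bounded from $L^\Phi(\mathbb R^n)$ to $\mathrm wL^\Psi(\mathbb R^n)$, then there is a constant $A>0$ such that $(*)$ holds for all $r\in(0,\infty)$. -/

import Mathlib

open MeasureTheory Set Filter Topology
open scoped ENNReal NNReal

namespace OrliczMax

noncomputable section

/-! ### Generalized Young functions

Functions `[0,∞] → [0,∞]` are functions `ℝ≥0∞ → ℝ≥0∞`. -/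

/-- `a(Φ) = sup {t ≥ 0 : Φ(t) = 0}` (and `sup ∅ = 0`). -/
def lowerEnd (Φ : ℝ≥0∞ → ℝ≥0∞) : ℝ≥0∞ := sSup {t | Φ t = 0}

/-- `b(Φ) = inf {t ≥ 0 : Φ(t) = ∞}` (and `inf ∅ = ∞`). -/
def upperEnd (Φ : ℝ≥0∞ → ℝ≥0∞) : ℝ≥0∞ := sInf {t | Φ t = ∞}

/-- The class of increasing functions `Φ : [0,∞] → [0,∞]` with `a(Φ) < ∞`, `0 < b(Φ)`,
`lim_{t → +0} Φ(t) = Φ(0) = 0`, left continuous on `[0, b(Φ))`, and with the stated left limit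
at `b(Φ)`. -/
structure IsPhi (Φ : ℝ≥0∞ → ℝ≥0∞) : Prop where
  mono : Monotone Φ
  lowerEnd_lt_top : lowerEnd Φ < ∞
  upperEnd_pos : 0 < upperEnd Φ
  map_zero : Φ 0 = 0
  tendsto_zero : Tendsto Φ (𝓝[>] 0) (𝓝 0)
  left_cont : ∀ t < upperEnd Φ, ContinuousWithinAt Φ (Iic t) t
  tendsto_top : upperEnd Φ = ∞ → Tendsto Φ (𝓝[<] ∞) (𝓝 ∞) ∧ Φ ∞ = ∞
  tendsto_upperEnd : upperEnd Φ < ∞ → Tendsto Φ (𝓝[<] (upperEnd Φ)) (𝓝 (Φ (upperEnd Φ)))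

/-- Young functions: members of the class above that are convex on `[0, b(Φ))`. -/
structure IsYoung (Φ : ℝ≥0∞ → ℝ≥0∞) : Prop extends IsPhi Φ where
  convexOn : ConvexOn ℝ≥0 (Iio (upperEnd Φ)) Φ

/-- `Φ ≈ Ψ`: for some constant `C > 0`, `Φ(t / C) ≤ Ψ(t) ≤ Φ(C t)` for all `t ∈ [0,∞]`. -/
def Approx (Φ Ψ : ℝ≥0∞ → ℝ≥0∞) : Prop :=
  ∃ C : ℝ≥0, 0 < C ∧ ∀ t : ℝ≥0∞, Φ ((C : ℝ≥0∞)⁻¹ * t) ≤ Ψ t ∧ Ψ t ≤ Φ ((C : ℝ≥0∞) * t)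

/-- Generalized Young functions: members of the class `IsPhi` equivalent to a Young function. -/
def IsGenYoung (Φ : ℝ≥0∞ → ℝ≥0∞) : Prop :=
  IsPhi Φ ∧ ∃ Ψ : ℝ≥0∞ → ℝ≥0∞, IsYoung Ψ ∧ Approx Φ Ψ

/-- The generalized inverse: `Φ⁻¹(u) = inf {t ≥ 0 : Φ(t) > u}` for `u < ∞`, and `Φ⁻¹(∞) = ∞`. -/
def genInv (Φ : ℝ≥0∞ → ℝ≥0∞) (u : ℝ≥0∞) : ℝ≥0∞ :=
  if u = ∞ then ∞ else sInf {t | u < Φ t}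

/-- The `∇₂`-condition: for some `k > 1`, `Φ(t) ≤ Φ(k t) / (2k)` for all `t > 0`. -/
def Nabla2 (Φ : ℝ≥0∞ → ℝ≥0∞) : Prop :=
  ∃ k : ℝ≥0, 1 < k ∧
    ∀ t : ℝ≥0, 0 < t → Φ t ≤ (2 * (k : ℝ≥0∞))⁻¹ * Φ ((k : ℝ≥0∞) * (t : ℝ≥0∞))

/-! ### Orlicz and weak Orlicz spaces on `ℝⁿ`

The functionals depend on `|f|` only, so they are defined for functions with values in `[0,∞]`;
a complex-valued `f` enters through `fun x => ‖f x‖ₑ`, and a maximal function directly.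
Lebesgue measurability is `AEMeasurable` for Lebesgue measure. -/

/-- `‖g‖_{L^Φ} = inf {λ > 0 : ∫ Φ(g / λ) ≤ 1}`, equal to `∞` if there is no such `λ`. -/
def orliczNorm {n : ℕ} (Φ : ℝ≥0∞ → ℝ≥0∞) (g : EuclideanSpace ℝ (Fin n) → ℝ≥0∞) : ℝ≥0∞ :=
  ⨅ (l : ℝ≥0) (_ : 0 < l) (_ : (∫⁻ x, Φ (g x / (l : ℝ≥0∞))) ≤ 1), (l : ℝ≥0∞)

/-- The distribution function `m(g, t) = |{x : g(x) > t}|`. -/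
def distrib {n : ℕ} (g : EuclideanSpace ℝ (Fin n) → ℝ≥0∞) (t : ℝ≥0∞) : ℝ≥0∞ :=
  volume {x | t < g x}

/-- `‖g‖_{wL^Φ} = inf {λ > 0 : sup_{0 < t < ∞} Φ(t) m(g / λ, t) ≤ 1}`, equal to `∞` if there is
no such `λ`. -/
def weakOrliczNorm {n : ℕ} (Φ : ℝ≥0∞ → ℝ≥0∞) (g : EuclideanSpace ℝ (Fin n) → ℝ≥0∞) : ℝ≥0∞ :=
  ⨅ (l : ℝ≥0) (_ : 0 < l)
    (_ : (⨆ (t : ℝ≥0) (_ : 0 < t), Φ t * distrib (fun x => g x / (l : ℝ≥0∞)) t) ≤ 1), (l : ℝ≥0∞)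

/-- Membership of a `[0,∞]`-valued function in `L^Φ(ℝⁿ)`: it is measurable, finite almost
everywhere, and `∫ Φ(ε g) < ∞` for some `ε > 0`. -/
def MemOrlicz {n : ℕ} (Φ : ℝ≥0∞ → ℝ≥0∞) (g : EuclideanSpace ℝ (Fin n) → ℝ≥0∞) : Prop :=
  AEMeasurable g volume ∧ (∀ᵐ x, g x < ∞) ∧
    ∃ ε : ℝ≥0, 0 < ε ∧ (∫⁻ x, Φ ((ε : ℝ≥0∞) * g x)) < ∞

/-- Membership of a `[0,∞]`-valued function in `wL^Φ(ℝⁿ)`: it is measurable, finite almost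
everywhere, and `sup_{0 < t < ∞} Φ(t) m(ε g, t) < ∞` for some `ε > 0`. -/
def MemWeakOrlicz {n : ℕ} (Φ : ℝ≥0∞ → ℝ≥0∞) (g : EuclideanSpace ℝ (Fin n) → ℝ≥0∞) : Prop :=
  AEMeasurable g volume ∧ (∀ᵐ x, g x < ∞) ∧
    ∃ ε : ℝ≥0, 0 < ε ∧
      (⨆ (t : ℝ≥0) (_ : 0 < t), Φ t * distrib (fun x => (ε : ℝ≥0∞) * g x) t) < ∞

/-- `f ∈ L^Φ(ℝⁿ)` for a complex-valued function `f`. -/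
def InOrlicz {n : ℕ} (Φ : ℝ≥0∞ → ℝ≥0∞) (f : EuclideanSpace ℝ (Fin n) → ℂ) : Prop :=
  AEMeasurable f volume ∧ MemOrlicz Φ (fun x => ‖f x‖ₑ)

/-! ### Maximal operators -/

/-- The generalized fractional maximal operator
`M_ρ f(x) = sup_{B(z,r) ∋ x} ρ(r) |B(z,r)|⁻¹ ∫_{B(z,r)} |f|`. -/
def fracMaximal {n : ℕ} (ρ : ℝ → ℝ) (f : EuclideanSpace ℝ (Fin n) → ℂ)
    (x : EuclideanSpace ℝ (Fin n)) : ℝ≥0∞ :=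
  ⨆ (z : EuclideanSpace ℝ (Fin n)) (r : ℝ) (_ : 0 < r) (_ : x ∈ Metric.ball z r),
    ENNReal.ofReal (ρ r) * ((volume (Metric.ball z r))⁻¹ * ∫⁻ y in Metric.ball z r, ‖f y‖ₑ)

/-- The (uncentered) Hardy-Littlewood maximal operator. -/
def hlMaximal {n : ℕ} (f : EuclideanSpace ℝ (Fin n) → ℂ)
    (x : EuclideanSpace ℝ (Fin n)) : ℝ≥0∞ :=
  ⨆ (z : EuclideanSpace ℝ (Fin n)) (r : ℝ) (_ : 0 < r) (_ : x ∈ Metric.ball z r),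
    (volume (Metric.ball z r))⁻¹ * ∫⁻ y in Metric.ball z r, ‖f y‖ₑ

/-- `T` is bounded from `L^Φ(ℝⁿ)` to `L^Ψ(ℝⁿ)`. -/
def StrongBounded {n : ℕ}
    (T : (EuclideanSpace ℝ (Fin n) → ℂ) → EuclideanSpace ℝ (Fin n) → ℝ≥0∞)
    (Φ Ψ : ℝ≥0∞ → ℝ≥0∞) : Prop :=
  ∃ C : ℝ≥0, 0 < C ∧ ∀ f : EuclideanSpace ℝ (Fin n) → ℂ, InOrlicz Φ f →
    MemOrlicz Ψ (T f) ∧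
      orliczNorm Ψ (T f) ≤ (C : ℝ≥0∞) * orliczNorm Φ (fun x => ‖f x‖ₑ)

/-- `T` is bounded from `L^Φ(ℝⁿ)` to `wL^Ψ(ℝⁿ)`. -/
def WeakBounded {n : ℕ}
    (T : (EuclideanSpace ℝ (Fin n) → ℂ) → EuclideanSpace ℝ (Fin n) → ℝ≥0∞)
    (Φ Ψ : ℝ≥0∞ → ℝ≥0∞) : Prop :=
  ∃ C : ℝ≥0, 0 < C ∧ ∀ f : EuclideanSpace ℝ (Fin n) → ℂ, InOrlicz Φ f →
    MemWeakOrlicz Ψ (T f) ∧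
      weakOrliczNorm Ψ (T f) ≤ (C : ℝ≥0∞) * orliczNorm Φ (fun x => ‖f x‖ₑ)

/-- The condition: for some `A > 0` and all `r ∈ (0,∞)`,
`(sup_{0 < t ≤ r} ρ(t)) Φ⁻¹(1/rⁿ) ≤ A Ψ⁻¹(1/rⁿ)`, the supremum being taken in `[0,∞]`. -/
def RhoCondition (n : ℕ) (ρ : ℝ → ℝ) (Φ Ψ : ℝ≥0∞ → ℝ≥0∞) : Prop :=
  ∃ A : ℝ≥0, 0 < A ∧ ∀ r : ℝ, 0 < r →
    (⨆ (t : ℝ) (_ : 0 < t) (_ : t ≤ r), ENNReal.ofReal (ρ t)) *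
        genInv Φ (ENNReal.ofReal (1 / r ^ n)) ≤
      (A : ℝ≥0∞) * genInv Ψ (ENNReal.ofReal (1 / r ^ n))

end

end OrliczMax

namespace OrliczMax


/-! Equivalence with a Young function enters only through the inequality `Φ (c * t) ≤ c * Φ (D * t)`
for `c ≤ 1`. It yields a linear bound `t ≤ D s (1 + Φ(t)/u)` whenever `u ≤ Φ s`. Integrating this
over a ball gives both a Jensen inequality and, for `∫ Φ(g) ≤ 1`, the bound of the average of `g`
over a ball of radius `r` by `K Φ⁻¹(1/rⁿ)`. Neither complementary functions nor Hölder's inequality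
are needed.

The core is a Hedberg-type argument (`exists_map_maxFn_le`). For finite `w > Φ(Mg/C₀)`, choose `r₀`
with `r₀⁻ⁿ = w`. On balls of radius `r ≤ r₀` the average is at most `Mg ≤ C₀ Φ⁻¹(r₀⁻ⁿ)`; on larger
balls it is at most `K Φ⁻¹(r⁻ⁿ)`. Condition (*), at `r₀` or at `r`, turns `ρ(r)` times the average
into at most a constant times `Ψ⁻¹(w)`. Hence `Ψ(M_ρ g/C₁) ≤ w`.

With Jensen, `Φ(Mg/C₀) ≤ M(Φ∘g)`, so the weak (1,1) inequality for `M` gives the weak bound. Under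
`∇₂` Jensen also applies to `Φ^(1/p)` for some `p > 1`, so `Φ(Mg/C₀) ≤ (M(Φ^(1/p)∘g))^p`, and the
strong (p,p) inequality gives the strong bound. For the converse, indicators of balls are tested:
`M_ρ 1_B ≥ sup_{t ≤ r} ρ(t)` on `B = B(0,r)`. -/

/-- Monotone, left continuous functions `Φ` on `[0,∞]` with `Φ(0) = 0`, `Φ(∞) = ∞` and
`Φ(c t) ≤ c Φ(D t)` for `c ≤ 1`. -/
structure QuasiYoung (D : ℝ≥0) (Φ : ℝ≥0∞ → ℝ≥0∞) : Prop where
  mono : Monotone Φ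
  le_of_forall_lt : ∀ t u, (∀ s < t, Φ s ≤ u) → Φ t ≤ u
  map_top : Φ ∞ = ∞
  map_mul_le : ∀ c : ℝ≥0, c ≤ 1 → ∀ t, Φ (c * t) ≤ c * Φ (D * t)

/-! ### Reduction of generalized Young functions to `QuasiYoung`. -/

theorem IsPhi.map_top {Φ : ℝ≥0∞ → ℝ≥0∞} (h : IsPhi Φ) : Φ ∞ = ∞ := by
  rcases eq_or_ne (upperEnd Φ) ∞ with hb | hb
  · exact (h.tendsto_top hb).2
  · obtain ⟨t, ht, -⟩ := sInf_lt_iff.1 (lt_top_iff_ne_top.2 hb)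
    exact top_le_iff.1 (le_of_eq_of_le (show Φ t = ∞ from ht).symm (h.mono le_top))

theorem IsPhi.eq_top_of_upperEnd_lt {Φ : ℝ≥0∞ → ℝ≥0∞} (h : IsPhi Φ) {t : ℝ≥0∞}
    (ht : upperEnd Φ < t) : Φ t = ∞ := by
  obtain ⟨s, hs, hst⟩ := sInf_lt_iff.1 ht
  exact top_le_iff.1 ((show Φ s = ∞ from hs) ▸ h.mono hst.le)

theorem IsPhi.le_of_forall_lt {Φ : ℝ≥0∞ → ℝ≥0∞} (h : IsPhi Φ) (t u : ℝ≥0∞)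
    (hs : ∀ s < t, Φ s ≤ u) : Φ t ≤ u := by
  rcases eq_or_ne t 0 with rfl | ht0
  · simp [h.map_zero]
  have hne : (𝓝[<] t).NeBot := nhdsLT_neBot_of_exists_lt ⟨0, pos_iff_ne_zero.2 ht0⟩
  have key : Tendsto Φ (𝓝[<] t) (𝓝 (Φ t)) → Φ t ≤ u := fun hT =>
    le_of_tendsto hT (eventually_nhdsWithin_of_forall fun s hs' => hs s hs')
  rcases lt_trichotomy t (upperEnd Φ) with hlt | heq | hgt
  · exact key ((h.left_cont t hlt).mono Iio_subset_Iic_self)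
  · rcases eq_or_ne t ∞ with rfl | ht
    · have := h.tendsto_top heq.symm
      exact key (this.2.symm ▸ this.1)
    · have := h.tendsto_upperEnd (heq ▸ lt_top_iff_ne_top.2 ht)
      rw [← heq] at this
      exact key this
  -- Beyond `b(Φ)` there need not be left continuity in the usual sense, but some `s < t` already
  -- has `Φ s = ∞`, which forces `u = ∞`.
  · obtain ⟨s, hs1, hs2⟩ := exists_between hgt
    have := hs s hs2
    rw [h.eq_top_of_upperEnd_lt hs1] at this
    rw [top_le_iff.1 this]
    exact le_top

/-- Convexity against the point `0` covers `[0, b(Φ))`; left continuity extends it to `t = b(Φ)`,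
and above that the right side is infinite. -/
theorem IsYoung.map_mul_le {Φ : ℝ≥0∞ → ℝ≥0∞} (h : IsYoung Φ) (c : ℝ≥0) (hc : c ≤ 1)
    (t : ℝ≥0∞) : Φ (c * t) ≤ c * Φ t := by
  rcases eq_or_ne c 0 with rfl | hc0
  · simp [h.map_zero]
  have lt_case : ∀ s < upperEnd Φ, Φ (c * s) ≤ c * Φ s := by
    intro s hs
    have := h.convexOn.2 hs (show (0 : ℝ≥0∞) ∈ Iio (upperEnd Φ) from h.upperEnd_pos)
      (zero_le : 0 ≤ c) (zero_le : 0 ≤ 1 - c) (add_tsub_cancel_of_le hc)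
    simpa [h.map_zero, ENNReal.smul_def] using this
  rcases lt_or_ge (upperEnd Φ) t with hlt | hle
  · rw [h.eq_top_of_upperEnd_lt hlt, ENNReal.mul_top (by simpa using hc0)]
    exact le_top
  · refine h.le_of_forall_lt _ _ fun s hs => ?_
    have hs' : (c : ℝ≥0∞)⁻¹ * s < t := by
      rw [mul_comm, ← div_eq_mul_inv]
      exact ENNReal.div_lt_of_lt_mul' hs
    have := lt_case _ (hs'.trans_le hle)
    rw [← mul_assoc, ENNReal.mul_inv_cancel (by simpa using hc0) (by simp), one_mul] at this
    exact this.trans (mul_le_mul_right (h.mono hs'.le) _)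

theorem IsGenYoung.exists_quasiYoung {Φ : ℝ≥0∞ → ℝ≥0∞} (h : IsGenYoung Φ) :
    ∃ D : ℝ≥0, QuasiYoung D Φ := by
  obtain ⟨hΦ, Φ₁, hY, C, hC, hA⟩ := h
  refine ⟨C * C, hΦ.mono, hΦ.le_of_forall_lt, hΦ.map_top, fun c hc t => ?_⟩
  have hC0 : (C : ℝ≥0∞) ≠ 0 := by simpa using hC.ne'
  calc Φ (c * t) = Φ ((C : ℝ≥0∞)⁻¹ * (c * (C * t))) := by
        congr 1
        rw [mul_left_comm (c : ℝ≥0∞), ← mul_assoc, ENNReal.inv_mul_cancel hC0 (by simp), one_mul]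
    _ ≤ Φ₁ (c * (C * t)) := (hA _).1
    _ ≤ c * Φ₁ (C * t) := hY.map_mul_le c hc _
    _ ≤ c * Φ (C * (C * t)) := mul_le_mul_right (hA _).2 _
    _ = _ := by rw [ENNReal.coe_mul, mul_assoc]

/-- The infimum defining `genInv` need not be attained in `{Φ > u}`; this reduces upper bounds by `a
* genInv Φ u` to finite points of that set. -/
theorem le_mul_genInv {Φ : ℝ≥0∞ → ℝ≥0∞} {u v a : ℝ≥0∞} (hu : u ≠ ∞) (ha : a ≠ ∞)
    (hv : ∀ s, s ≠ ∞ → u < Φ s → v ≤ a * s) (ha0 : a ≠ 0) : v ≤ a * genInv Φ u := by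
  rw [genInv, if_neg hu, mul_comm, ← ENNReal.div_le_iff ha0 ha]
  refine le_sInf fun s hs => ?_
  rcases eq_or_ne s ∞ with rfl | hs'
  · exact le_top
  · rw [ENNReal.div_le_iff ha0 ha, mul_comm]
    exact hv s hs' hs

/-! ### Inverses, Jensen's inequality and powers. -/

namespace QuasiYoung

variable {D : ℝ≥0} {Φ : ℝ≥0∞ → ℝ≥0∞}

theorem map_zero (h : QuasiYoung D Φ) : Φ 0 = 0 :=
  le_antisymm (h.le_of_forall_lt _ _ fun _ hs => absurd hs not_lt_zero) zero_le

theorem const_ne_zero (h : QuasiYoung D Φ) : D ≠ 0 := by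
  rintro rfl
  have := h.map_mul_le 1 le_rfl ∞
  simp [h.map_zero, h.map_top] at this

/-- Left continuity makes `genInv Φ` an upper adjoint of `Φ` at finite levels. Estimates of `Φ` and
of its inverse are exchanged through this equivalence. -/
theorem le_genInv_iff (h : QuasiYoung D Φ) {t u : ℝ≥0∞} (hu : u ≠ ∞) :
    t ≤ genInv Φ u ↔ Φ t ≤ u := by
  rw [genInv, if_neg hu]
  constructor
  · refine fun ht => h.le_of_forall_lt _ _ fun s hs => ?_
    by_contra! hus
    exact absurd (ht.trans (sInf_le hus)) hs.not_ge
  · refine fun ht => le_sInf fun s hs => ?_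
    by_contra! hst
    exact absurd ((h.mono hst.le).trans ht) (not_le.2 hs)

theorem genInv_ne_top (h : QuasiYoung D Φ) {u : ℝ≥0∞} (hu : u ≠ ∞) : genInv Φ u ≠ ∞ := by
  intro ht
  have := (h.le_genInv_iff hu).1 ht.ge
  rw [h.map_top, top_le_iff] at this
  exact hu this

theorem genInv_mono (h : QuasiYoung D Φ) : Monotone (genInv Φ) := by
  intro u v huv
  rcases eq_or_ne v ∞ with rfl | hv
  · simp [genInv]
  · have hu : u ≠ ∞ := ne_top_of_le_ne_top hv huv
    exact (h.le_genInv_iff hv).2 (((h.le_genInv_iff hu).1 le_rfl).trans huv)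

theorem genInv_mul_le (h : QuasiYoung D Φ) {κ : ℝ≥0} (hκ : 1 ≤ κ) {u : ℝ≥0∞} (hu : u ≠ ∞) :
    genInv Φ (κ * u) ≤ (D * κ : ℝ≥0) * genInv Φ u := by
  have hκ0 : κ ≠ 0 := (zero_lt_one.trans_le hκ).ne'
  have hκ0' : (κ : ℝ≥0∞) ≠ 0 := by simpa using hκ0
  refine le_mul_genInv hu ENNReal.coe_ne_top (fun s _ hs => ?_)
    (by simpa using ⟨h.const_ne_zero, hκ0⟩)
  rw [genInv, if_neg (ENNReal.mul_ne_top (by simp) hu)]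
  refine sInf_le (show κ * u < Φ _ from ?_)
  have := h.map_mul_le κ⁻¹ (inv_le_one_of_one_le₀ hκ) (κ * s)
  rw [ENNReal.coe_inv hκ0, ← mul_assoc, ENNReal.inv_mul_cancel hκ0' (by simp), one_mul,
    ← mul_assoc, ← ENNReal.coe_mul] at this
  have h2 := hs.trans_le this
  rw [mul_comm, ← div_eq_mul_inv, ENNReal.lt_div_iff_mul_lt (Or.inl hκ0') (by simp), mul_comm] at h2
  exact h2

/-- A substitute for a supporting line. If `t ≤ D s` there is nothing to prove; otherwise
`map_mul_le` with `c = D s / t` at the point `t / D` gives `Φ(s) ≤ (D s / t) Φ(t)`. -/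
theorem le_add_mul_div (h : QuasiYoung D Φ) {s u : ℝ≥0∞} (hs : s ≠ ∞) (hu0 : u ≠ 0)
    (hu : u ≠ ∞) (hus : u ≤ Φ s) (t : ℝ≥0∞) : t ≤ D * s * (1 + u⁻¹ * Φ t) := by
  have hD : (D : ℝ≥0∞) ≠ 0 := by simpa using h.const_ne_zero
  have hs0 : s ≠ 0 := by
    rintro rfl
    rw [h.map_zero] at hus
    exact hu0 (le_antisymm hus zero_le)
  rcases eq_or_ne t ∞ with rfl | ht
  · rw [h.map_top, ENNReal.mul_top (by simpa using hu), add_top, ENNReal.mul_top (by simp [*])]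
  rcases le_total t (D * s) with hle | hle
  · exact hle.trans (le_mul_of_one_le_right' le_self_add)
  · have ht0 : t ≠ 0 := fun h0 => mul_ne_zero hD hs0 (le_antisymm (h0 ▸ hle) zero_le)
    have hc : D * s / t ≤ 1 := ENNReal.div_le_of_le_mul (by simpa using hle)
    have hcne : D * s / t ≠ ∞ := ne_top_of_le_ne_top (by simp) hc
    have key := h.map_mul_le (D * s / t).toNNReal (by
      rw [← ENNReal.coe_le_coe, ENNReal.coe_toNNReal hcne]; simpa using hc) (t / D)
    rw [ENNReal.coe_toNNReal hcne, ENNReal.mul_div_cancel hD (by simp)] at key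
    have e : D * s / t * (t / D) = s := by
      rw [div_eq_mul_inv, div_eq_mul_inv, mul_assoc, ← mul_assoc t⁻¹,
        ENNReal.inv_mul_cancel ht0 ht, one_mul, mul_right_comm,
        ENNReal.mul_inv_cancel hD (by simp), one_mul]
    rw [e] at key
    have h2 : u * t ≤ D * s * Φ t := by
      have := mul_le_mul_left (hus.trans key) t
      refine this.trans (le_of_eq ?_)
      rw [div_eq_mul_inv, mul_right_comm, mul_assoc (D * s : ℝ≥0∞), ENNReal.inv_mul_cancel ht0 ht,
        mul_one]
    calc t = u⁻¹ * (u * t) := by rw [← mul_assoc, ENNReal.inv_mul_cancel hu0 hu, one_mul]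
      _ ≤ u⁻¹ * (D * s * Φ t) := mul_le_mul_right h2 _
      _ = D * s * (u⁻¹ * Φ t) := by ring
      _ ≤ _ := mul_le_mul_right le_add_self _

theorem lintegral_le {α : Type*} [MeasurableSpace α] (μ : Measure α) (h : QuasiYoung D Φ)
    {s u : ℝ≥0∞} (hs : s ≠ ∞) (hu0 : u ≠ 0) (hu : u ≠ ∞) (hus : u ≤ Φ s) (g : α → ℝ≥0∞) :
    ∫⁻ x, g x ∂μ ≤ D * s * (μ univ + u⁻¹ * ∫⁻ x, Φ (g x) ∂μ) := by
  calc ∫⁻ x, g x ∂μ ≤ ∫⁻ x, D * s * (1 + u⁻¹ * Φ (g x)) ∂μ :=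
        lintegral_mono fun x => h.le_add_mul_div hs hu0 hu hus _
    _ = _ := by
        rw [lintegral_const_mul' _ _ (ENNReal.mul_ne_top (by simp) hs),
          lintegral_add_left measurable_const, lintegral_const_mul' _ _ (by simpa using hu0)]
        simp

/-- A form of Jensen's inequality. -/
theorem map_average_le {α : Type*} [MeasurableSpace α] (μ : Measure α) (h : QuasiYoung D Φ)
    (hμ0 : μ univ ≠ 0) (hμ : μ univ ≠ ∞) (g : α → ℝ≥0∞) :
    Φ (((2 * D : ℝ≥0) : ℝ≥0∞)⁻¹ * ((μ univ)⁻¹ * ∫⁻ x, g x ∂μ)) ≤ (μ univ)⁻¹ * ∫⁻ x, Φ (g x) ∂μ := by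
  set w := (μ univ)⁻¹ * ∫⁻ x, Φ (g x) ∂μ with hw
  rcases eq_or_ne w ∞ with hwt | hwt
  · rw [hwt]; exact le_top
  have hD2 : ((2 * D : ℝ≥0) : ℝ≥0∞) ≠ 0 := by simpa using h.const_ne_zero
  rw [← h.le_genInv_iff hwt, mul_comm, ← div_eq_mul_inv, ENNReal.div_le_iff hD2 ENNReal.coe_ne_top,
    mul_comm (genInv Φ w)]
  refine le_mul_genInv hwt ENNReal.coe_ne_top (fun s hs hws => ?_) hD2
  -- The intermediate level `u` is positive and finite even if `w = 0` or `Φ s = ∞`. Since `w ≤ u`,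
  -- the factor `1 + u⁻¹ w` is at most 2, whence the constant `2 * D`.
  obtain ⟨u, hwu, hus⟩ := exists_between hws
  have hu0 : u ≠ 0 := (zero_le.trans_lt hwu).ne'
  have hu : u ≠ ∞ := (hus.trans_le le_top).ne
  have e : ∫⁻ x, Φ (g x) ∂μ = w * μ univ := by
    rw [hw, mul_right_comm, ENNReal.inv_mul_cancel hμ0 hμ, one_mul]
  calc (μ univ)⁻¹ * ∫⁻ x, g x ∂μ
      ≤ (μ univ)⁻¹ * (D * s * (μ univ + u⁻¹ * (w * μ univ))) :=
        mul_le_mul_right (e ▸ h.lintegral_le μ hs hu0 hu hus.le g) _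
    _ = D * s * ((μ univ)⁻¹ * μ univ) * (1 + u⁻¹ * w) := by ring
    _ ≤ D * s * 1 * (1 + u⁻¹ * u) := by
        rw [ENNReal.inv_mul_cancel hμ0 hμ]
        gcongr
    _ = _ := by
        rw [ENNReal.inv_mul_cancel hu0 hu]
        push_cast
        ring

theorem scale_le (h : QuasiYoung D Φ) {K : ℝ≥0} (hK : 1 ≤ K) (t : ℝ≥0∞) :
    Φ (((D * K : ℝ≥0) : ℝ≥0∞)⁻¹ * t) ≤ (K : ℝ≥0∞)⁻¹ * Φ t := by
  have hK0 : K ≠ 0 := (zero_lt_one.trans_le hK).ne'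
  have hD : (D : ℝ≥0∞) ≠ 0 := by simpa using h.const_ne_zero
  have := h.map_mul_le K⁻¹ (inv_le_one_of_one_le₀ hK) ((D : ℝ≥0∞)⁻¹ * t)
  rw [ENNReal.coe_inv hK0, ← mul_assoc (D : ℝ≥0∞), ENNReal.mul_inv_cancel hD (by simp), one_mul,
    ← mul_assoc] at this
  rwa [ENNReal.coe_mul, ENNReal.mul_inv (by simp) (by simp), mul_comm (D : ℝ≥0∞)⁻¹]

theorem exists_lt_map (h : QuasiYoung D Φ) {u : ℝ≥0∞} (hu : u ≠ ∞) : ∃ s : ℝ≥0, u < Φ s := by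
  by_contra! hc
  have := h.le_of_forall_lt ∞ u fun s hs => by
    lift s to ℝ≥0 using hs.ne
    exact hc s
  rw [h.map_top, top_le_iff] at this
  exact hu this

/-- If `Φ ∈ ∇₂`, then a power `Φ ^ (1 / p)` with `p > 1` has the growth of a Young function. -/
theorem exists_rpow (h : QuasiYoung D Φ) (h2 : Nabla2 Φ) :
    ∃ p : ℝ, 1 < p ∧ ∃ k : ℝ≥0, QuasiYoung k (fun t => Φ t ^ p⁻¹) := by
  obtain ⟨k, hk1, hk⟩ := h2
  have hk0 : k ≠ 0 := (zero_lt_one.trans hk1).ne'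
  have hk0' : (k : ℝ≥0∞) ≠ 0 := by simpa using hk0
  have hkr : (1 : ℝ) < k := by exact_mod_cast hk1
  -- This `p` satisfies `k ^ p = 2 k`, so the `1/p`-th power of the `∇₂` inequality has the factor
  -- `k⁻¹` matching the dilation by `k`.
  set p : ℝ := Real.logb k (2 * k) with hp
  have hp1 : 1 < p := by
    rw [hp, Real.lt_logb_iff_rpow_lt hkr (by positivity), Real.rpow_one]
    linarith
  have hp0 : 0 < p := zero_lt_one.trans hp1
  have hkp : (2 * (k : ℝ≥0∞)) = (k : ℝ≥0∞) ^ p := by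
    have : (2 * k : ℝ≥0) = k ^ p := by
      rw [← NNReal.coe_inj]
      push_cast
      rw [hp, Real.rpow_logb (by linarith) hkr.ne' (by positivity)]
    rw [← ENNReal.coe_rpow_of_ne_zero hk0, ← this]
    push_cast; rfl
  have hinv : 0 < p⁻¹ := inv_pos.2 hp0
  have hk' : ∀ t : ℝ≥0∞, Φ t ^ p⁻¹ ≤ (k : ℝ≥0∞)⁻¹ * Φ (k * t) ^ p⁻¹ := by
    intro t
    rcases eq_or_ne t ∞ with rfl | ht
    · rw [ENNReal.mul_top hk0', h.map_top, ENNReal.top_rpow_of_pos hinv,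
        ENNReal.mul_top (by simp)]
    rcases eq_or_ne t 0 with rfl | ht0
    · simp [h.map_zero, hp0]
    lift t to ℝ≥0 using ht
    have := ENNReal.rpow_le_rpow (hk t (pos_iff_ne_zero.2 (by simpa using ht0))) hinv.le
    rwa [ENNReal.mul_rpow_of_nonneg _ _ hinv.le, hkp, ENNReal.inv_rpow,
      ENNReal.rpow_rpow_inv hp0.ne'] at this
  have hpow : ∀ (m : ℕ) (t : ℝ≥0∞), Φ t ^ p⁻¹ ≤ ((k : ℝ≥0∞)⁻¹) ^ m * Φ (k ^ m * t) ^ p⁻¹ := by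
    intro m t
    induction m with
    | zero => simp
    | succ m ih =>
      refine ih.trans ?_
      rw [pow_succ, mul_assoc, pow_succ' (k : ℝ≥0∞), mul_assoc]
      exact mul_le_mul_right (hk' _) _
  refine ⟨p, hp1, k, fun s t hst => ENNReal.rpow_le_rpow (h.mono hst) hinv.le, fun t u hs => ?_,
    by simp [h.map_top, hp0], fun c hc t => ?_⟩
  · rw [ENNReal.rpow_inv_le_iff hp0]
    exact h.le_of_forall_lt _ _ fun s hst => (ENNReal.rpow_inv_le_iff hp0).1 (hs s hst)
  · rcases eq_or_ne c 0 with rfl | hc0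
    · simp [h.map_zero, hp0]
    -- With `k^m ≤ c⁻¹ < k^(m+1)`, iterating `m + 1` times gains a factor at most `c`, while the
    -- argument overshoots `t` by at most one factor `k`.
    obtain ⟨m, hm1, hm2⟩ := exists_nat_pow_near (one_le_inv_iff₀.2 ⟨pos_iff_ne_zero.2 hc0, hc⟩) hk1
    have hm1' : ((k : ℝ≥0∞) ^ (m + 1))⁻¹ ≤ c := by
      rw [ENNReal.inv_le_iff_inv_le, ← ENNReal.coe_inv hc0]
      exact_mod_cast hm2.le
    have hm2' : (k : ℝ≥0∞) ^ m * c ≤ 1 := by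
      rw [← ENNReal.le_div_iff_mul_le (by simp [hc0]) (by simp), one_div, ← ENNReal.coe_inv hc0]
      exact_mod_cast hm1
    calc Φ (c * t) ^ p⁻¹ ≤ ((k : ℝ≥0∞)⁻¹) ^ (m + 1) * Φ (k ^ (m + 1) * (c * t)) ^ p⁻¹ := hpow _ _
      _ ≤ c * Φ (k * t) ^ p⁻¹ := by
        rw [← ENNReal.inv_pow]
        refine mul_le_mul' hm1' (ENNReal.rpow_le_rpow (h.mono ?_) hinv.le)
        calc (k : ℝ≥0∞) ^ (m + 1) * (c * t) = k ^ m * c * (k * t) := by ring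
          _ ≤ 1 * (k * t) := mul_le_mul_left hm2' _
          _ = _ := one_mul _

end QuasiYoung


/-! ### Maximal functions: weak (1,1) and strong (p,p) inequalities. -/

variable {n : ℕ}

/-- The maximal function `x ↦ sup_{B(z,r) ∋ x} w(r) |B(z,r)|⁻¹ ∫_{B(z,r)} g`. -/
noncomputable def maxFn (w : ℝ → ℝ≥0∞) (g : EuclideanSpace ℝ (Fin n) → ℝ≥0∞)
    (x : EuclideanSpace ℝ (Fin n)) : ℝ≥0∞ :=
  ⨆ (z : EuclideanSpace ℝ (Fin n)) (r : ℝ) (_ : 0 < r) (_ : x ∈ Metric.ball z r),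
    w r * ((volume (Metric.ball z r))⁻¹ * ∫⁻ y in Metric.ball z r, g y)

theorem fracMaximal_eq (ρ : ℝ → ℝ) (f : EuclideanSpace ℝ (Fin n) → ℂ) :
    fracMaximal ρ f = maxFn (fun r => ENNReal.ofReal (ρ r)) (fun y => ‖f y‖ₑ) := rfl

theorem hlMaximal_eq (f : EuclideanSpace ℝ (Fin n) → ℂ) :
    hlMaximal f = maxFn (fun _ => 1) (fun y => ‖f y‖ₑ) := by
  funext x
  simp [hlMaximal, maxFn]

theorem le_maxFn (w : ℝ → ℝ≥0∞) (g : EuclideanSpace ℝ (Fin n) → ℝ≥0∞)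
    {x z : EuclideanSpace ℝ (Fin n)} {r : ℝ} (hr : 0 < r) (hx : x ∈ Metric.ball z r) :
    w r * ((volume (Metric.ball z r))⁻¹ * ∫⁻ y in Metric.ball z r, g y) ≤ maxFn w g x :=
  le_iSup₂_of_le z r (le_iSup₂_of_le hr hx le_rfl)

theorem average_le_maxFn (g : EuclideanSpace ℝ (Fin n) → ℝ≥0∞)
    {x z : EuclideanSpace ℝ (Fin n)} {r : ℝ} (hr : 0 < r) (hx : x ∈ Metric.ball z r) :
    (volume (Metric.ball z r))⁻¹ * ∫⁻ y in Metric.ball z r, g y ≤ maxFn (fun _ => 1) g x := by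
  simpa using le_maxFn (fun _ => 1) g hr hx

theorem maxFn_le_iff {w : ℝ → ℝ≥0∞} {g : EuclideanSpace ℝ (Fin n) → ℝ≥0∞}
    {x : EuclideanSpace ℝ (Fin n)} {a : ℝ≥0∞} :
    maxFn w g x ≤ a ↔ ∀ z r, 0 < r → x ∈ Metric.ball z r →
      w r * ((volume (Metric.ball z r))⁻¹ * ∫⁻ y in Metric.ball z r, g y) ≤ a := by
  simp only [maxFn, iSup_le_iff]

theorem lt_maxFn_iff {w : ℝ → ℝ≥0∞} {g : EuclideanSpace ℝ (Fin n) → ℝ≥0∞}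
    {x : EuclideanSpace ℝ (Fin n)} {a : ℝ≥0∞} :
    a < maxFn w g x ↔ ∃ z r, 0 < r ∧ x ∈ Metric.ball z r ∧
      a < w r * ((volume (Metric.ball z r))⁻¹ * ∫⁻ y in Metric.ball z r, g y) := by
  simp only [maxFn, lt_iSup_iff, exists_prop]

/-- The maximal function is uncentered, so a ball that is a witness at `x` serves all of its points.
This gives measurability for arbitrary weights `w`. -/
theorem isOpen_lt_maxFn (w : ℝ → ℝ≥0∞) (g : EuclideanSpace ℝ (Fin n) → ℝ≥0∞) (a : ℝ≥0∞) :
    IsOpen {x | a < maxFn w g x} := by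
  refine isOpen_iff_mem_nhds.2 fun x hx => ?_
  obtain ⟨z, r, hr, hxz, h⟩ := lt_maxFn_iff.1 hx
  filter_upwards [Metric.isOpen_ball.mem_nhds hxz] with y hy
  exact lt_maxFn_iff.2 ⟨z, r, hr, hy, h⟩

theorem measurable_maxFn (w : ℝ → ℝ≥0∞) (g : EuclideanSpace ℝ (Fin n) → ℝ≥0∞) :
    Measurable (maxFn w g) :=
  measurable_of_Ioi fun a => (isOpen_lt_maxFn w g a).measurableSet

theorem maxFn_congr_ae (w : ℝ → ℝ≥0∞) {g g' : EuclideanSpace ℝ (Fin n) → ℝ≥0∞}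
    (h : g =ᵐ[volume] g') : maxFn w g = maxFn w g' := by
  funext x
  have : ∀ z r, ∫⁻ y in Metric.ball z r, g y = ∫⁻ y in Metric.ball z r, g' y := fun z r =>
    lintegral_congr_ae (ae_restrict_of_ae h)
  simp only [maxFn, this]

theorem maxFn_const_mul (w : ℝ → ℝ≥0∞) (g : EuclideanSpace ℝ (Fin n) → ℝ≥0∞) {c : ℝ≥0∞}
    (hc : c ≠ ∞) (x : EuclideanSpace ℝ (Fin n)) :
    maxFn w (fun y => c * g y) x = c * maxFn w g x := by
  simp only [maxFn, ENNReal.mul_iSup, lintegral_const_mul' _ _ hc]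
  simp only [mul_left_comm c]

theorem volume_ball_ne_zero (z : EuclideanSpace ℝ (Fin n)) {r : ℝ} (hr : 0 < r) :
    volume (Metric.ball z r) ≠ 0 := (Metric.measure_ball_pos _ _ hr).ne'

theorem volume_ball_eq (z : EuclideanSpace ℝ (Fin n)) {r : ℝ} (hr : 0 < r) :
    volume (Metric.ball z r) =
      ENNReal.ofReal (r ^ n) * volume (Metric.ball (0 : EuclideanSpace ℝ (Fin n)) 1) := by
  simpa using Measure.addHaar_ball_of_pos volume z hr

theorem QuasiYoung.map_maxFn_le {D : ℝ≥0} {Φ : ℝ≥0∞ → ℝ≥0∞} (h : QuasiYoung D Φ)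
    (g : EuclideanSpace ℝ (Fin n) → ℝ≥0∞) (x : EuclideanSpace ℝ (Fin n)) :
    Φ (((2 * D : ℝ≥0) : ℝ≥0∞)⁻¹ * maxFn (fun _ => 1) g x) ≤
      maxFn (fun _ => 1) (fun y => Φ (g y)) x := by
  have hD2 : ((2 * D : ℝ≥0) : ℝ≥0∞)⁻¹ ≠ ∞ := by
    rw [ENNReal.inv_ne_top]
    simpa using h.const_ne_zero
  refine h.le_of_forall_lt _ _ fun s hs => ?_
  rw [← maxFn_const_mul _ _ hD2, lt_maxFn_iff] at hs
  obtain ⟨z, r, hr, hx, hs⟩ := hs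
  rw [lintegral_const_mul' _ _ hD2, one_mul, mul_left_comm] at hs
  have := h.map_average_le (volume.restrict (Metric.ball z r))
    (by simpa using volume_ball_ne_zero z hr) (by simpa using measure_ball_lt_top.ne) g
  rw [Measure.restrict_apply_univ] at this
  exact (h.mono hs.le).trans (this.trans (average_le_maxFn _ hr hx))

/-- The weak type `(1,1)` inequality for the maximal function. -/
theorem mul_volume_lt_maxFn_le (hn : 1 ≤ n) (g : EuclideanSpace ℝ (Fin n) → ℝ≥0∞) (t : ℝ≥0∞) :
    t * volume {x | t < maxFn (fun _ => 1) g x} ≤ 5 ^ n * ∫⁻ x, g x := by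
  have : Nonempty (Fin n) := ⟨⟨0, hn⟩⟩
  set I := ∫⁻ x, g x with hI
  rcases eq_or_ne I ∞ with hIt | hIt
  · rw [hIt, ENNReal.mul_top (by simp)]; exact le_top
  rcases eq_or_ne t 0 with rfl | ht0
  · simp
  let E := EuclideanSpace ℝ (Fin n)
  -- Vitali's covering lemma is applied to the balls with average above `t`. Their radii are bounded
  -- because `t |B| ≤ ∫ g < ∞`.
  let T : Set (E × ℝ) := {q | 0 < q.2 ∧ t * volume (Metric.ball q.1 q.2) <
    ∫⁻ y in Metric.ball q.1 q.2, g y}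
  have hT : ∀ q ∈ T, t * volume (Metric.ball q.1 q.2) ≤ I := fun q hq =>
    hq.2.le.trans (setLIntegral_le_lintegral _ _)
  have hc0 : volume (Metric.ball (0 : E) 1) ≠ 0 := volume_ball_ne_zero _ one_pos
  set c := volume (Metric.ball (0 : E) 1) with hc
  have hct : c ≠ ∞ := measure_ball_lt_top.ne
  obtain ⟨R, hR⟩ : ∃ R : ℝ, ∀ q ∈ T, q.2 ≤ R := by
    have hfin : I / (t * c) ≠ ∞ := ENNReal.div_ne_top hIt (mul_ne_zero ht0 hc0)
    refine ⟨max 1 (I / (t * c)).toReal, fun q hq => ?_⟩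
    by_contra! hlt
    have h1 : 1 < q.2 := (le_max_left _ _).trans_lt hlt
    have h2 := (le_max_right _ _).trans_lt hlt
    have h3 := hT q hq
    rw [volume_ball_eq _ hq.1, ← hc] at h3
    have h4 : q.2 ≤ q.2 ^ n := le_self_pow₀ h1.le (by lia)
    have h5 : ENNReal.ofReal (q.2 ^ n) ≤ I / (t * c) := by
      rcases eq_or_ne t ∞ with rfl | htt
      · rw [ENNReal.top_mul] at h3
        · exact absurd (top_le_iff.1 h3) hIt
        · refine mul_ne_zero ?_ hc0
          simpa using pow_pos hq.1 n
      rw [ENNReal.le_div_iff_mul_le (Or.inl (mul_ne_zero ht0 hc0))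
        (Or.inl (ENNReal.mul_ne_top htt hct))]
      calc _ = t * (ENNReal.ofReal (q.2 ^ n) * c) := by ring
        _ ≤ _ := h3
    have h6 := (ENNReal.ofReal_le_iff_le_toReal hfin).1 h5
    linarith
  obtain ⟨U, hUT, hUd, hU⟩ := Vitali.exists_disjoint_subfamily_covering_enlargement_closedBall
    T (fun q => q.1) (fun q => q.2) R hR 5 (by norm_num)
  have hUd' : U.PairwiseDisjoint fun q => Metric.ball q.1 q.2 :=
    hUd.mono fun q => Metric.ball_subset_closedBall
  have hUc : U.Countable := hUd'.countable_of_isOpen (fun _ _ => Metric.isOpen_ball)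
    fun q hq => Metric.nonempty_ball.2 (hUT hq).1
  have hcover : {x | t < maxFn (fun _ => 1) g x} ⊆ ⋃ q ∈ U, Metric.closedBall q.1 (5 * q.2) := by
    intro x hx
    obtain ⟨z, r, hr, hxz, h⟩ := lt_maxFn_iff.1 hx
    rw [one_mul, mul_comm, ← div_eq_mul_inv, ENNReal.lt_div_iff_mul_lt
      (Or.inl (volume_ball_ne_zero z hr)) (Or.inl measure_ball_lt_top.ne)] at h
    obtain ⟨q, hq, hsub⟩ := hU (z, r) ⟨hr, h⟩
    exact mem_iUnion₂.2 ⟨q, hq, hsub (Metric.ball_subset_closedBall hxz)⟩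
  have := hUc.to_subtype
  calc t * volume {x | t < maxFn (fun _ => 1) g x}
      ≤ t * ∑' q : U, volume (Metric.closedBall q.1.1 (5 * q.1.2)) := by
        gcongr
        refine (measure_mono hcover).trans ?_
        rw [biUnion_eq_iUnion]
        exact measure_iUnion_le _
    _ = ∑' q : U, 5 ^ n * (t * volume (Metric.ball q.1.1 q.1.2)) := by
        rw [← ENNReal.tsum_mul_left]
        congr 1 with q
        have hq := (hUT q.2).1
        rw [Measure.addHaar_closedBall volume _ (by positivity), finrank_euclideanSpace_fin,
          volume_ball_eq _ hq, mul_pow, ENNReal.ofReal_mul (by positivity)]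
        rw [ENNReal.ofReal_pow (by norm_num), ENNReal.ofReal_ofNat]
        ring
    _ ≤ ∑' q : U, 5 ^ n * ∫⁻ y in Metric.ball q.1.1 q.1.2, g y := by
        gcongr with q
        exact (hUT q.2).2.le
    _ = 5 ^ n * ∫⁻ y in ⋃ q : U, Metric.ball q.1.1 q.1.2, g y := by
        rw [ENNReal.tsum_mul_left, lintegral_iUnion (fun _ => measurableSet_ball)
          (hUd'.subtype _ _)]
    _ ≤ 5 ^ n * I := by
        gcongr
        exact setLIntegral_le_lintegral _ _

/-- Since `g ≤ t/2 + g 1_{2g > t}`, the bounded part contributes at most `t/2` to each average; the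
weak (1,1) inequality is applied to the rest at level `t/2`. -/
theorem mul_volume_lt_maxFn_le_setLIntegral (hn : 1 ≤ n)
    {g : EuclideanSpace ℝ (Fin n) → ℝ≥0∞} (hg : Measurable g) {t : ℝ≥0∞} (ht : t ≠ ∞) :
    t * volume {x | t < maxFn (fun _ => 1) g x} ≤ 2 * 5 ^ n * ∫⁻ x in {x | t < 2 * g x}, g x := by
  have hS : MeasurableSet {x | t < 2 * g x} := measurableSet_lt measurable_const (hg.const_mul 2)
  have hsub : {x | t < maxFn (fun _ => 1) g x} ⊆
      {x | t / 2 < maxFn (fun _ => 1) ({x | t < 2 * g x}.indicator g) x} := by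
    intro x hx
    obtain ⟨z, r, hr, hxz, h⟩ := lt_maxFn_iff.1 hx
    refine lt_maxFn_iff.2 ⟨z, r, hr, hxz, ?_⟩
    have hg' : ∀ y, g y ≤ t / 2 + {x | t < 2 * g x}.indicator g y := by
      intro y
      by_cases hy : t < 2 * g y
      · rw [indicator_of_mem (by exact hy)]
        exact le_add_self
      · rw [indicator_of_notMem (by exact hy), add_zero, ENNReal.le_div_iff_mul_le (by simp) (by simp),
          mul_comm]
        exact not_lt.1 hy
    have h0 := volume_ball_ne_zero z hr
    have h2 : (volume (Metric.ball z r))⁻¹ * ∫⁻ y in Metric.ball z r, g y ≤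
        t / 2 + (volume (Metric.ball z r))⁻¹ *
          ∫⁻ y in Metric.ball z r, {x | t < 2 * g x}.indicator g y := by
      calc _ ≤ (volume (Metric.ball z r))⁻¹ *
            ∫⁻ y in Metric.ball z r, (t / 2 + {x | t < 2 * g x}.indicator g y) := by
              gcongr with y
              exact hg' y
        _ = _ := by
          rw [lintegral_add_left measurable_const, mul_add, setLIntegral_const,
            mul_comm (t / 2), ← mul_assoc, ENNReal.inv_mul_cancel h0 measure_ball_lt_top.ne,
            one_mul]
    rw [one_mul] at h ⊢
    have h3 := (ENNReal.add_halves t).trans_lt (h.trans_le h2)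
    exact (ENNReal.add_lt_add_iff_left (ENNReal.div_ne_top ht (by simp))).1 h3
  calc t * volume {x | t < maxFn (fun _ => 1) g x}
      ≤ t * volume {x | t / 2 < maxFn (fun _ => 1) ({x | t < 2 * g x}.indicator g) x} := by
        gcongr
    _ = 2 * (t / 2 * volume {x | t / 2 < maxFn (fun _ => 1) ({x | t < 2 * g x}.indicator g) x}) := by
        rw [← mul_assoc, ENNReal.mul_div_cancel (by simp) (by simp)]
    _ ≤ 2 * (5 ^ n * ∫⁻ x, {x | t < 2 * g x}.indicator g x) := by
        exact mul_le_mul_right (mul_volume_lt_maxFn_le hn _ _) _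
    _ = _ := by rw [lintegral_indicator hS, mul_assoc]

theorem lintegral_Ioi_ite_rpow {q : ℝ} (hq : 0 < q) (v : ℝ≥0∞) :
    ∫⁻ t in Ioi (0 : ℝ), (if ENNReal.ofReal t < v then ENNReal.ofReal (q * t ^ (q - 1)) else 0) =
      v ^ q := by
  have fin : ∀ a : ℝ≥0, ∫⁻ t in Ioi (0 : ℝ),
      (if ENNReal.ofReal t < a then ENNReal.ofReal (q * t ^ (q - 1)) else 0) =
        (a : ℝ≥0∞) ^ q := by
    intro a
    have e : ∀ t ∈ Ioi (0 : ℝ), (if ENNReal.ofReal t < a then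
        ENNReal.ofReal (q * t ^ (q - 1)) else 0) =
        (Iio (a : ℝ)).indicator (fun t => ENNReal.ofReal (q * t ^ (q - 1))) t := by
      intro t ht
      rw [indicator_apply]
      congr 1
      rw [mem_Iio, ENNReal.ofReal_lt_iff_lt_toReal (le_of_lt ht) ENNReal.coe_ne_top,
        ENNReal.coe_toReal]
    have hint : IntegrableOn (fun t : ℝ => q * t ^ (q - 1)) (Ioc 0 a) :=
      ((intervalIntegrable_iff_integrableOn_Ioc_of_le a.coe_nonneg).1
        (intervalIntegral.intervalIntegrable_rpow' (by linarith))).const_mul q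
    rw [setLIntegral_congr_fun measurableSet_Ioi e, lintegral_indicator measurableSet_Iio,
      Measure.restrict_restrict measurableSet_Iio, inter_comm, Ioi_inter_Iio,
      restrict_Ioo_eq_restrict_Ioc, ← ofReal_integral_eq_lintegral_ofReal hint,
      ← intervalIntegral.integral_of_le a.coe_nonneg, intervalIntegral.integral_const_mul,
      integral_rpow (Or.inl (by linarith)), sub_add_cancel, Real.zero_rpow hq.ne', sub_zero,
      mul_div_cancel₀ _ hq.ne', ← ENNReal.ofReal_rpow_of_nonneg a.coe_nonneg hq.le,
      ENNReal.ofReal_coe_nnreal]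
    · exact (ae_restrict_iff' measurableSet_Ioc).2 (.of_forall fun t ht => by
        have := ht.1; positivity)
  rcases eq_or_ne v ∞ with rfl | hv
  · rw [ENNReal.top_rpow_of_pos hq]
    refine ENNReal.eq_top_of_forall_nnreal_le fun a => ?_
    have h1 : (a : ℝ≥0∞) = ((a ^ q⁻¹ : ℝ≥0) : ℝ≥0∞) ^ q := by
      rw [← ENNReal.coe_rpow_of_nonneg _ hq.le, NNReal.rpow_inv_rpow hq.ne']
    rw [h1, ← fin]
    refine lintegral_mono fun t => ?_
    simp only [ENNReal.ofReal_lt_top, if_true]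
    split_ifs <;> simp
  · lift v to ℝ≥0 using hv
    exact fin v

/-- Layer-cake formula with a weight `F`, used with `F = 1` for `Mg` and with `F = g` for the
truncated integrals of `g`. -/
theorem lintegral_rpow_eq_lintegral_volume_lt {g : EuclideanSpace ℝ (Fin n) → ℝ≥0∞}
    (hg : Measurable g) {q : ℝ} (hq : 0 < q) (F : EuclideanSpace ℝ (Fin n) → ℝ≥0∞)
    (hF : Measurable F) :
    ∫⁻ x, F x * g x ^ q = ∫⁻ t in Ioi (0 : ℝ),
      ENNReal.ofReal (q * t ^ (q - 1)) * ∫⁻ x in {x | ENNReal.ofReal t < g x}, F x := by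
  have hset : MeasurableSet {y : EuclideanSpace ℝ (Fin n) × ℝ | ENNReal.ofReal y.2 < g y.1} :=
    measurableSet_lt (by fun_prop) (by fun_prop)
  have hmeas : Measurable (fun y : EuclideanSpace ℝ (Fin n) × ℝ => F y.1 *
      (if ENNReal.ofReal y.2 < g y.1 then ENNReal.ofReal (q * y.2 ^ (q - 1)) else 0)) :=
    (hF.comp measurable_fst).mul (Measurable.ite hset (by fun_prop) measurable_const)
  calc ∫⁻ x, F x * g x ^ q
      = ∫⁻ x, ∫⁻ t in Ioi (0 : ℝ), F x *
          (if ENNReal.ofReal t < g x then ENNReal.ofReal (q * t ^ (q - 1)) else 0) := by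
        congr 1 with x
        rw [lintegral_const_mul _ (Measurable.ite (measurableSet_lt (by fun_prop) measurable_const)
          (by fun_prop) measurable_const), lintegral_Ioi_ite_rpow hq]
    _ = ∫⁻ t in Ioi (0 : ℝ), ∫⁻ x, F x *
          (if ENNReal.ofReal t < g x then ENNReal.ofReal (q * t ^ (q - 1)) else 0) :=
        lintegral_lintegral_swap hmeas.aemeasurable
    _ = _ := by
        congr 1 with t
        rw [← lintegral_const_mul' _ _ ENNReal.ofReal_ne_top,
          ← lintegral_indicator (measurableSet_lt measurable_const hg)]
        congr 1 with x
        by_cases h : ENNReal.ofReal t < g x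
        · rw [indicator_of_mem (by exact h), if_pos h, mul_comm]
        · rw [indicator_of_notMem (by exact h), if_neg h, mul_zero]

/-- The strong type `(p,p)` inequality for the maximal function. -/
theorem exists_lintegral_maxFn_rpow_le (hn : 1 ≤ n) {p : ℝ} (hp : 1 < p) :
    ∃ C : ℝ≥0, ∀ g : EuclideanSpace ℝ (Fin n) → ℝ≥0∞, AEMeasurable g →
      ∫⁻ x, maxFn (fun _ => 1) g x ^ p ≤ C * ∫⁻ x, g x ^ p := by
  have hp0 : 0 < p := zero_lt_one.trans hp
  have hp1 : 0 < p - 1 := sub_pos.2 hp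
  set K : ℝ≥0∞ := 2 * 5 ^ n * ENNReal.ofReal (p / (p - 1)) with hK
  have hKt : K ≠ ∞ := by simp [hK, ENNReal.mul_eq_top]
  have h2t : (2 : ℝ≥0∞) ^ (p - 1) ≠ ∞ := ENNReal.rpow_ne_top_of_nonneg hp1.le (by simp)
  refine ⟨(K * 2 ^ (p - 1)).toNNReal, fun g hg => ?_⟩
  rw [ENNReal.coe_toNNReal (ENNReal.mul_ne_top hKt h2t)]
  wlog hgm : Measurable g generalizing g
  · have := this (hg.mk g) hg.measurable_mk.aemeasurable hg.measurable_mk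
    rw [maxFn_congr_ae _ hg.ae_eq_mk]
    refine this.trans_eq ?_
    congr 1
    exact lintegral_congr_ae (hg.ae_eq_mk.mono fun x hx => by simp only [hx])
  calc ∫⁻ x, maxFn (fun _ => 1) g x ^ p
      = ∫⁻ t in Ioi (0 : ℝ), ENNReal.ofReal (p * t ^ (p - 1)) *
          volume {x | ENNReal.ofReal t < maxFn (fun _ => 1) g x} := by
        simpa using lintegral_rpow_eq_lintegral_volume_lt (measurable_maxFn (fun _ => 1) g) hp0
          (fun _ => 1) measurable_const
    _ ≤ ∫⁻ t in Ioi (0 : ℝ), K * (ENNReal.ofReal ((p - 1) * t ^ (p - 1 - 1)) *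
          ∫⁻ x in {x | ENNReal.ofReal t < 2 * g x}, g x) := by
        refine setLIntegral_mono' measurableSet_Ioi fun t (ht : 0 < t) => ?_
        -- One factor `t` is split off for the truncated weak inequality; what remains is the
        -- layer-cake density of exponent `p - 1`.
        have e : ENNReal.ofReal (p * t ^ (p - 1)) =
            ENNReal.ofReal (p / (p - 1)) * ENNReal.ofReal ((p - 1) * t ^ (p - 1 - 1)) *
              ENNReal.ofReal t := by
          rw [← ENNReal.ofReal_mul (by positivity), ← ENNReal.ofReal_mul (by positivity)]
          congr 1
          rw [Real.rpow_sub_one ht.ne' (p - 1)]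
          field_simp
        rw [e, mul_assoc]
        refine (mul_le_mul_right (mul_volume_lt_maxFn_le_setLIntegral hn hgm
          ENNReal.ofReal_ne_top) _).trans_eq ?_
        rw [hK]
        ring
    _ = K * ∫⁻ x, g x * (2 * g x) ^ (p - 1) := by
        rw [lintegral_const_mul' _ _ hKt,
          lintegral_rpow_eq_lintegral_volume_lt (hgm.const_mul 2) hp1 g hgm]
    _ = K * 2 ^ (p - 1) * ∫⁻ x, g x ^ p := by
        rw [mul_assoc K, ← lintegral_const_mul' _ _ h2t]
        congr 2 with x
        rw [ENNReal.mul_rpow_of_nonneg _ _ hp1.le, mul_left_comm]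
        congr 1
        nth_rw 1 [← ENNReal.rpow_one (g x)]
        rw [← ENNReal.rpow_add_of_nonneg _ _ zero_le_one hp1.le, add_sub_cancel]


/-! ### Orlicz norms. -/

variable {D E : ℝ≥0} {Φ Ψ : ℝ≥0∞ → ℝ≥0∞}

theorem orliczNorm_lt_iff {g : EuclideanSpace ℝ (Fin n) → ℝ≥0∞} {a : ℝ≥0∞} :
    orliczNorm Φ g < a ↔ ∃ l : ℝ≥0, 0 < l ∧ (∫⁻ x, Φ (g x / l)) ≤ 1 ∧ (l : ℝ≥0∞) < a := by
  simp only [orliczNorm, iInf_lt_iff, exists_prop]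

theorem orliczNorm_le {g : EuclideanSpace ℝ (Fin n) → ℝ≥0∞} {l : ℝ≥0} (hl : 0 < l)
    (h : (∫⁻ x, Φ (g x / l)) ≤ 1) : orliczNorm Φ g ≤ l :=
  iInf₂_le_of_le l hl (iInf_le _ h)

theorem weakOrliczNorm_le {g : EuclideanSpace ℝ (Fin n) → ℝ≥0∞} {l : ℝ≥0} (hl : 0 < l)
    (h : ∀ t : ℝ≥0, Φ t * distrib (fun x => g x / l) t ≤ 1) : weakOrliczNorm Φ g ≤ l :=
  iInf₂_le_of_le l hl (iInf_le_of_le (iSup₂_le fun t _ => h t) le_rfl)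

theorem weakOrliczNorm_lt_iff {g : EuclideanSpace ℝ (Fin n) → ℝ≥0∞} {a : ℝ≥0∞} :
    weakOrliczNorm Φ g < a ↔ ∃ l : ℝ≥0, 0 < l ∧
      (∀ t : ℝ≥0, 0 < t → Φ t * distrib (fun x => g x / l) t ≤ 1) ∧ (l : ℝ≥0∞) < a := by
  simp only [weakOrliczNorm, iInf_lt_iff, exists_prop, iSup_le_iff]

theorem le_mul_orliczNorm {g : EuclideanSpace ℝ (Fin n) → ℝ≥0∞} {W : ℝ≥0∞} {C : ℝ≥0} (hC : 0 < C)
    (h : ∀ l : ℝ≥0, 0 < l → (∫⁻ x, Φ (g x / l)) ≤ 1 → W ≤ (C * l : ℝ≥0)) :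
    W ≤ C * orliczNorm Φ g := by
  have hC0 : (C : ℝ≥0∞) ≠ 0 := by simpa using hC.ne'
  by_contra! hlt
  have h1 : orliczNorm Φ g < W / C := by
    rwa [ENNReal.lt_div_iff_mul_lt (Or.inl hC0) (by simp), mul_comm]
  obtain ⟨l, hl, hle, hlW⟩ := orliczNorm_lt_iff.1 h1
  rw [ENNReal.lt_div_iff_mul_lt (Or.inl hC0) (by simp), mul_comm, ← ENNReal.coe_mul] at hlW
  exact absurd (h l hl hle) hlW.not_ge

theorem QuasiYoung.exists_lintegral_le_one (h : QuasiYoung D Φ)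
    {g : EuclideanSpace ℝ (Fin n) → ℝ≥0∞} (hg : MemOrlicz Φ g) :
    ∃ l : ℝ≥0, 0 < l ∧ (∫⁻ x, Φ (g x / l)) ≤ 1 := by
  obtain ⟨-, -, ε, hε, hI⟩ := hg
  set I := ∫⁻ x, Φ (ε * g x)
  set K : ℝ≥0 := max 1 I.toNNReal with hK
  have hK1 : 1 ≤ K := le_max_left _ _
  have hK0 : 0 < K := zero_lt_one.trans_le hK1
  have hKI : I ≤ K := by
    rw [← ENNReal.coe_toNNReal hI.ne]
    exact_mod_cast le_max_right _ _
  have hK0' : (K : ℝ≥0∞) ≠ 0 := by simpa using hK0.ne'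
  have hD : 0 < D := pos_iff_ne_zero.2 h.const_ne_zero
  refine ⟨D * K / ε, by positivity, ?_⟩
  calc ∫⁻ x, Φ (g x / (D * K / ε : ℝ≥0))
      = ∫⁻ x, Φ (((D * K : ℝ≥0) : ℝ≥0∞)⁻¹ * (ε * g x)) := by
        congr 1 with x
        congr 1
        rw [ENNReal.coe_div hε.ne', div_eq_mul_inv, ENNReal.inv_div (by simp)
          (by simp [hε.ne']), div_eq_mul_inv]
        ring
    _ ≤ ∫⁻ x, (K : ℝ≥0∞)⁻¹ * Φ (ε * g x) := lintegral_mono fun x => h.scale_le hK1 _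
    _ = (K : ℝ≥0∞)⁻¹ * I := lintegral_const_mul' _ _ (by simpa using hK0.ne')
    _ ≤ (K : ℝ≥0∞)⁻¹ * K := by gcongr
    _ = 1 := ENNReal.inv_mul_cancel hK0' (by simp)

/-- The linear bound with `Φ s > 1` gives `∫_B |f| ≤ l D s (|B| + 1)` for each admissible `l`, and
admissible `l` can be arbitrarily small. -/
theorem QuasiYoung.ae_eq_zero_of_orliczNorm_eq_zero (h : QuasiYoung D Φ)
    {f : EuclideanSpace ℝ (Fin n) → ℂ} (hf : AEMeasurable f)
    (h0 : orliczNorm Φ (fun x => ‖f x‖ₑ) = 0) : f =ᵐ[volume] 0 := by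
  obtain ⟨s, hs⟩ := h.exists_lt_map (u := 1) (by simp)
  have hball : ∀ k : ℕ, ∫⁻ x in Metric.ball (0 : EuclideanSpace ℝ (Fin n)) k, ‖f x‖ₑ = 0 := by
    intro k
    set B := Metric.ball (0 : EuclideanSpace ℝ (Fin n)) k
    by_contra hJ
    set c : ℝ≥0∞ := D * s * (volume B + 1)
    have hc : c ≠ ∞ := ENNReal.mul_ne_top (by simp [ENNReal.mul_eq_top])
      (by simpa using measure_ball_lt_top.ne)
    have hpos : orliczNorm Φ (fun x => ‖f x‖ₑ) < (∫⁻ x in B, ‖f x‖ₑ) / c := by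
      rw [h0]
      exact ENNReal.div_pos hJ hc
    obtain ⟨l, hl, hle, hlt⟩ := orliczNorm_lt_iff.1 hpos
    have hl0 : (l : ℝ≥0∞) ≠ 0 := by simpa using hl.ne'
    have key := h.lintegral_le (volume.restrict B) (s := s) (u := 1) (by simp) (by simp) (by simp)
      hs.le (fun x => ‖f x‖ₑ / l)
    have hle' : ∫⁻ x in B, Φ (‖f x‖ₑ / l) ≤ 1 := (setLIntegral_le_lintegral _ _).trans hle
    simp only [div_eq_mul_inv] at key hle'
    rw [lintegral_mul_const' _ _ (by simpa using hl.ne'), Measure.restrict_apply_univ, inv_one,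
      one_mul, ← div_eq_mul_inv, ENNReal.div_le_iff hl0 (by simp)] at key
    have : ∫⁻ x in B, ‖f x‖ₑ ≤ c * l :=
      key.trans (mul_le_mul_left (mul_le_mul_right (add_le_add_right hle' _) _) _)
    exact absurd (hlt.trans_le (ENNReal.div_le_of_le_mul (this.trans_eq (mul_comm _ _)))) (lt_irrefl _)
  have hae : ∀ k : ℕ, ∀ᵐ x, x ∈ Metric.ball (0 : EuclideanSpace ℝ (Fin n)) k → f x = 0 := by
    intro k
    have := (lintegral_eq_zero_iff' hf.enorm.restrict).1 (hball k)
    filter_upwards [(ae_restrict_iff' measurableSet_ball).1 this] with x hx hxk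
    simpa using hx hxk
  filter_upwards [ae_all_iff.2 hae] with x hx
  obtain ⟨k, hk⟩ := exists_nat_gt ‖x‖
  exact hx k (by simpa using hk)

theorem QuasiYoung.average_le_genInv (h : QuasiYoung D Φ)
    {g : EuclideanSpace ℝ (Fin n) → ℝ≥0∞} (hg : ∫⁻ x, Φ (g x) ≤ 1)
    (z : EuclideanSpace ℝ (Fin n)) {r : ℝ} (hr : 0 < r) :
    (volume (Metric.ball z r))⁻¹ * ∫⁻ y in Metric.ball z r, g y ≤
      D * (1 + (volume (Metric.ball (0 : EuclideanSpace ℝ (Fin n)) 1))⁻¹) *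
        genInv Φ (ENNReal.ofReal (1 / r ^ n)) := by
  have hc0 := volume_ball_ne_zero (0 : EuclideanSpace ℝ (Fin n)) one_pos
  set c := volume (Metric.ball (0 : EuclideanSpace ℝ (Fin n)) 1)
  set B := Metric.ball z r
  have hrn : 0 < r ^ n := pow_pos hr n
  have hD : (D : ℝ≥0∞) ≠ 0 := by simpa using h.const_ne_zero
  have hu0 : ENNReal.ofReal (1 / r ^ n) ≠ 0 := by simpa using hrn
  refine le_mul_genInv (by simp) (ENNReal.mul_ne_top (by simp) (by simpa using hc0))
    (fun s hs hus => ?_) (mul_ne_zero hD (by simp))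
  have key := h.lintegral_le (volume.restrict B) hs hu0 (by simp) hus.le g
  rw [Measure.restrict_apply_univ] at key
  have hu : (ENNReal.ofReal (1 / r ^ n))⁻¹ = ENNReal.ofReal (r ^ n) := by
    rw [one_div, ENNReal.ofReal_inv_of_pos hrn, inv_inv]
  rw [hu] at key
  have hV0 : volume B ≠ 0 := volume_ball_ne_zero z hr
  calc (volume B)⁻¹ * ∫⁻ y in B, g y
      ≤ (volume B)⁻¹ * (D * s * (volume B + ENNReal.ofReal (r ^ n) * 1)) := by
        refine mul_le_mul_right (key.trans ?_) _
        gcongr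
        exact (setLIntegral_le_lintegral _ _).trans hg
    _ = D * s * ((volume B)⁻¹ * volume B + (volume B)⁻¹ * ENNReal.ofReal (r ^ n)) := by ring
    _ = D * s * (1 + c⁻¹) := by
        rw [ENNReal.inv_mul_cancel hV0 measure_ball_lt_top.ne, volume_ball_eq z hr,
          ENNReal.mul_inv (Or.inr measure_ball_lt_top.ne) (by simp),
          mul_right_comm _ _ (ENNReal.ofReal _),
          ENNReal.inv_mul_cancel (by simpa using hrn) (by simp), one_mul]
    _ = _ := by ring

/-! ### The pointwise estimate. -/

/-- The pointwise estimate of `M_ρ` by `M`, for normalized functions. -/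
theorem exists_map_maxFn_le (hn : 1 ≤ n) {ρ : ℝ → ℝ} (hΦ : QuasiYoung D Φ) (hΨ : QuasiYoung E Ψ)
    (hρ : RhoCondition n ρ Φ Ψ) {C₀ : ℝ≥0} (hC₀ : 0 < C₀) :
    ∃ C₁ : ℝ≥0, 0 < C₁ ∧ ∀ g : EuclideanSpace ℝ (Fin n) → ℝ≥0∞, ∫⁻ x, Φ (g x) ≤ 1 → ∀ x,
      Ψ (maxFn (fun r => ENNReal.ofReal (ρ r)) g x / C₁) ≤ Φ (maxFn (fun _ => 1) g x / C₀) := by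
  obtain ⟨A, hA, hρ⟩ := hρ
  have hc0 := volume_ball_ne_zero (0 : EuclideanSpace ℝ (Fin n)) one_pos
  obtain ⟨K, hK⟩ : ∃ K : ℝ≥0,
      D * (1 + (volume (Metric.ball (0 : EuclideanSpace ℝ (Fin n)) 1))⁻¹) = (K : ℝ≥0∞) :=
    ⟨_, (ENNReal.coe_toNNReal (ENNReal.mul_ne_top (by simp) (by simpa using hc0))).symm⟩
  have hC₁ : 0 < A * (C₀ + K) := by positivity
  refine ⟨A * (C₀ + K), hC₁, fun g hg x => ?_⟩
  have hC₁' : ((A * (C₀ + K) : ℝ≥0) : ℝ≥0∞) ≠ 0 := by simpa using hC₁.ne'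
  refine le_of_forall_gt_imp_ge_of_dense fun w hw => ?_
  rcases eq_or_ne w ∞ with rfl | hwt
  · exact le_top
  have hw0 : 0 < w.toReal := ENNReal.toReal_pos (zero_le.trans_lt hw).ne' hwt
  have hm : maxFn (fun _ => 1) g x ≤ C₀ * genInv Φ w := by
    have := (hΦ.le_genInv_iff hwt).2 hw.le
    rwa [ENNReal.div_le_iff (by simpa using hC₀.ne') (by simp), mul_comm] at this
  -- The critical radius, separating balls controlled by `Mg` from balls controlled by the norm of
  -- `g`.
  obtain ⟨r₀, hr₀, hwr⟩ : ∃ r₀ : ℝ, 0 < r₀ ∧ ENNReal.ofReal (1 / r₀ ^ n) = w := by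
    refine ⟨(w.toReal⁻¹) ^ ((n : ℝ)⁻¹), by positivity, ?_⟩
    rw [Real.rpow_inv_natCast_pow (by positivity) (by lia), one_div, inv_inv,
      ENNReal.ofReal_toReal hwt]
  rw [← hΨ.le_genInv_iff hwt, ENNReal.div_le_iff hC₁' ENNReal.coe_ne_top, mul_comm, maxFn_le_iff]
  intro z r hr hx
  have hS : ∀ R, r ≤ R → ENNReal.ofReal (ρ r) ≤
      ⨆ (t : ℝ) (_ : 0 < t) (_ : t ≤ R), ENNReal.ofReal (ρ t) := fun R hR =>
    le_iSup₂_of_le r hr (le_iSup_of_le hR le_rfl)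
  -- Used with `R = r₀`, `c = C₀` for small balls and with `R = r`, `c = K` for large ones. In both
  -- cases `r₀ ≤ R`, so `R⁻ⁿ ≤ w`.
  have main : ∀ (R : ℝ) (c : ℝ≥0), 0 < R → r ≤ R → r₀ ≤ R → c ≤ C₀ + K →
      (volume (Metric.ball z r))⁻¹ * ∫⁻ y in Metric.ball z r, g y ≤
        c * genInv Φ (ENNReal.ofReal (1 / R ^ n)) →
      ENNReal.ofReal (ρ r) * ((volume (Metric.ball z r))⁻¹ * ∫⁻ y in Metric.ball z r, g y) ≤
        (A * (C₀ + K) : ℝ≥0) * genInv Ψ w := by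
    intro R c hR hrR hr₀R hc hav
    calc _ ≤ _ := mul_le_mul' (hS R hrR) hav
      _ = c * _ := mul_left_comm _ _ _
      _ ≤ c * (A * genInv Ψ (ENNReal.ofReal (1 / R ^ n))) := mul_le_mul_right (hρ R hR) _
      _ ≤ (C₀ + K : ℝ≥0) * (A * genInv Ψ w) := by
        refine mul_le_mul' (by exact_mod_cast hc) (mul_le_mul_right (hΨ.genInv_mono ?_) _)
        rw [← hwr]
        gcongr
      _ = _ := by push_cast; ring
  rcases le_or_gt r r₀ with hle | hlt
  · exact main r₀ C₀ hr₀ hle le_rfl le_self_add (hwr ▸ (average_le_maxFn g hr hx).trans hm)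
  · exact main r K hr le_rfl hlt.le le_add_self (hK ▸ hΦ.average_le_genInv hg z hr)

theorem maxFn_div (w : ℝ → ℝ≥0∞) (g : EuclideanSpace ℝ (Fin n) → ℝ≥0∞) {l : ℝ≥0} (hl : 0 < l)
    (x : EuclideanSpace ℝ (Fin n)) : maxFn w (fun y => g y / l) x = maxFn w g x / l := by
  simp only [div_eq_mul_inv, mul_comm _ (l : ℝ≥0∞)⁻¹]
  exact maxFn_const_mul w g (by simpa using hl.ne') x

theorem pointwise_estimate (hn : 1 ≤ n) {ρ : ℝ → ℝ} (hΦ : QuasiYoung D Φ) (hΨ : QuasiYoung E Ψ)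
    (hρ : RhoCondition n ρ Φ Ψ) {C₀ : ℝ≥0} (hC₀ : 0 < C₀) :
    ∃ C₁ : ℝ≥0, 0 < C₁ ∧ ∀ f : EuclideanSpace ℝ (Fin n) → ℂ, InOrlicz Φ f → ¬ (f =ᵐ[volume] 0) →
      ∀ x, Ψ (fracMaximal ρ f x / (C₁ * orliczNorm Φ (fun y => ‖f y‖ₑ))) ≤
        Φ (hlMaximal f x / (C₀ * orliczNorm Φ (fun y => ‖f y‖ₑ))) := by
  obtain ⟨C₁, hC₁, key⟩ := exists_map_maxFn_le hn hΦ hΨ hρ hC₀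
  refine ⟨C₁, hC₁, fun f hf hf0 x => ?_⟩
  have hN0 : orliczNorm Φ (fun y => ‖f y‖ₑ) ≠ 0 := fun h0 =>
    hf0 (hΦ.ae_eq_zero_of_orliczNorm_eq_zero hf.1 h0)
  set N := orliczNorm Φ (fun y => ‖f y‖ₑ)
  have hC₁' : (C₁ : ℝ≥0∞) ≠ 0 := by simpa using hC₁.ne'
  rw [fracMaximal_eq, hlMaximal_eq]
  set F := maxFn (fun r => ENNReal.ofReal (ρ r)) (fun y => ‖f y‖ₑ) x
  -- The infimum `N` is not assumed to be attained. Passing to `s` strictly below the argument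
  -- leaves room for an admissible `l ≥ N`, to which the normalized estimate applies.
  refine hΨ.le_of_forall_lt _ _ fun s hs => ?_
  rcases eq_or_ne s 0 with rfl | hs0
  · rw [hΨ.map_zero]; exact zero_le
  have hst : s ≠ ∞ := (hs.trans_le le_top).ne
  have hlt : N < F / (s * C₁) := by
    rw [ENNReal.lt_div_iff_mul_lt (Or.inl (mul_ne_zero hs0 hC₁'))
      (Or.inl (ENNReal.mul_ne_top hst (by simp)))]
    have := ENNReal.mul_lt_of_lt_div hs
    calc N * (s * C₁) = s * (C₁ * N) := by ring
      _ < F := this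
  obtain ⟨l, hl, hle, hlF⟩ := orliczNorm_lt_iff.1 hlt
  have hNl : N ≤ l := orliczNorm_le hl hle
  have hl0 : (l : ℝ≥0∞) ≠ 0 := by simpa using hl.ne'
  have hsF : s ≤ F / l / C₁ := by
    rw [ENNReal.le_div_iff_mul_le (Or.inl hC₁') (by simp),
      ENNReal.le_div_iff_mul_le (Or.inl hl0) (by simp)]
    have := (ENNReal.mul_lt_of_lt_div hlF).le
    calc s * C₁ * l = l * (s * C₁) := by ring
      _ ≤ F := this
  have h1 := key _ hle x
  rw [maxFn_div _ _ hl, maxFn_div _ _ hl] at h1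
  refine (hΨ.mono hsF).trans (h1.trans (hΦ.mono ?_))
  rw [div_eq_mul_inv, div_eq_mul_inv, div_eq_mul_inv, mul_assoc, ENNReal.mul_inv (Or.inl (by simpa using hC₀.ne'))
    (Or.inl ENNReal.coe_ne_top), mul_comm (C₀ : ℝ≥0∞)⁻¹]
  gcongr

/-! ### Weak and strong boundedness. -/

theorem mul_distrib_maxFn_le (hn : 1 ≤ n) {ρ : ℝ → ℝ} (hΦ : QuasiYoung D Φ)
    (hΨ : QuasiYoung E Ψ) (hρ : RhoCondition n ρ Φ Ψ) :
    ∃ C : ℝ≥0, 0 < C ∧ ∀ g : EuclideanSpace ℝ (Fin n) → ℝ≥0∞, ∫⁻ x, Φ (g x) ≤ 1 → ∀ t : ℝ≥0,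
      Ψ t * distrib (fun x => maxFn (fun r => ENNReal.ofReal (ρ r)) g x / C) t ≤ 1 := by
  have hD : 0 < D := pos_iff_ne_zero.2 hΦ.const_ne_zero
  have hE : 0 < E := pos_iff_ne_zero.2 hΨ.const_ne_zero
  -- The choice `C₀ = 2 D` is the constant of Jensen's inequality, so that `Φ(Mg/C₀) ≤ M(Φ∘g)`. The
  -- factor `5ⁿ` from the weak (1,1) inequality is absorbed later by dilating the argument of `Ψ`.
  obtain ⟨C₁, hC₁, key⟩ := exists_map_maxFn_le hn hΦ hΨ hρ (C₀ := 2 * D) (by positivity)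
  set K : ℝ≥0 := 5 ^ n with hK
  have hK1 : 1 ≤ K := one_le_pow₀ (by norm_num)
  have hK0 : 0 < K := zero_lt_one.trans_le hK1
  have hEK : 0 < E * K := by positivity
  refine ⟨C₁ * (E * K), by positivity, fun g hg t => ?_⟩
  set F := maxFn (fun r => ENNReal.ofReal (ρ r)) g
  have h1 : ∀ x, Ψ (F x / C₁) ≤ maxFn (fun _ => 1) (fun y => Φ (g y)) x := by
    intro x
    refine (key g hg x).trans (le_trans (le_of_eq ?_) (hΦ.map_maxFn_le g x))
    rw [div_eq_mul_inv, mul_comm]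
  have h2 : ∀ τ : ℝ≥0∞, Ψ τ * volume {x | τ < F x / C₁} ≤ K := by
    intro τ
    refine ENNReal.mul_le_of_forall_lt fun a ha b hb => ?_
    have hsub : {x | τ < F x / C₁} ⊆ {x | a < maxFn (fun _ => 1) (fun y => Φ (g y)) x} :=
      fun x (hx : τ < F x / C₁) => (ha.trans_le (hΨ.mono hx.le)).trans_le (h1 x)
    calc a * b ≤ a * volume {x | a < maxFn (fun _ => 1) (fun y => Φ (g y)) x} :=
          mul_le_mul_right (hb.le.trans (measure_mono hsub)) _
      _ ≤ 5 ^ n * ∫⁻ x, Φ (g x) := mul_volume_lt_maxFn_le hn _ _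
      _ ≤ 5 ^ n * 1 := by gcongr
      _ = K := by simp [hK]
  have hEK0 : ((E * K : ℝ≥0) : ℝ≥0∞) ≠ 0 := by simpa using hEK.ne'
  have hC₁0 : (C₁ : ℝ≥0∞) ≠ 0 := by simpa using hC₁.ne'
  have hK0' : (K : ℝ≥0∞) ≠ 0 := by simpa using hK0.ne'
  have h3 : distrib (fun x => F x / (C₁ * (E * K) : ℝ≥0)) t =
      volume {x | ((E * K : ℝ≥0) : ℝ≥0∞) * t < F x / C₁} := by
    unfold distrib
    congr 1 with x
    simp only [mem_ofPred_eq]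
    rw [ENNReal.lt_div_iff_mul_lt (Or.inl hC₁0) (by simp), ENNReal.lt_div_iff_mul_lt
      (Or.inl (by simpa using ⟨hC₁.ne', hE.ne', hK0.ne'⟩)) (Or.inl ENNReal.coe_ne_top), ENNReal.coe_mul C₁]
    ring_nf
  have h4 : Ψ t ≤ (K : ℝ≥0∞)⁻¹ * Ψ ((E * K : ℝ≥0) * t) := by
    have := hΨ.scale_le hK1 ((E * K : ℝ≥0) * t)
    rwa [← mul_assoc, ENNReal.inv_mul_cancel hEK0 ENNReal.coe_ne_top, one_mul] at this
  calc _ ≤ (K : ℝ≥0∞)⁻¹ * Ψ ((E * K : ℝ≥0) * t) *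
        volume {x | ((E * K : ℝ≥0) : ℝ≥0∞) * t < F x / C₁} := by
        rw [h3]; gcongr
    _ ≤ (K : ℝ≥0∞)⁻¹ * K := by
        rw [mul_assoc]; exact mul_le_mul_right (h2 _) _
    _ = 1 := ENNReal.inv_mul_cancel hK0' (by simp)

theorem weakBounded_fracMaximal (hn : 1 ≤ n) {ρ : ℝ → ℝ} (hΦ : QuasiYoung D Φ)
    (hΨ : QuasiYoung E Ψ) (hρ : RhoCondition n ρ Φ Ψ) :
    WeakBounded (n := n) (fracMaximal ρ) Φ Ψ := by
  obtain ⟨C, hC, key⟩ := mul_distrib_maxFn_le hn hΦ hΨ hρ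
  have key' : ∀ (f : EuclideanSpace ℝ (Fin n) → ℂ) (l : ℝ≥0), 0 < l →
      (∫⁻ x, Φ (‖f x‖ₑ / l)) ≤ 1 → ∀ t : ℝ≥0,
      Ψ t * distrib (fun x => fracMaximal ρ f x / (C * l : ℝ≥0)) t ≤ 1 := by
    intro f l hl hle t
    convert key _ hle t using 3
    funext x
    rw [maxFn_div _ _ hl, fracMaximal_eq, div_eq_mul_inv, div_eq_mul_inv, div_eq_mul_inv,
      mul_assoc, ENNReal.coe_mul, ENNReal.mul_inv (by simp) (by simp), mul_comm (C : ℝ≥0∞)⁻¹]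
  refine ⟨C, hC, fun f hf => ⟨⟨(measurable_maxFn _ _).aemeasurable, ?_, ?_⟩,
    le_mul_orliczNorm hC fun l hl hle => weakOrliczNorm_le (by positivity) (key' f l hl hle)⟩⟩
  · obtain ⟨l, hl, hle⟩ := hΦ.exists_lintegral_le_one hf.2
    -- On the set where `M_ρ f = ∞`, of measure `V`, the weak estimate gives `Ψ(t) V ≤ 1` for every
    -- finite `t`; as `Ψ` is unbounded there, `V = 0`.
    by_contra hV
    rw [ae_iff] at hV
    set V := volume {x | ¬ fracMaximal ρ f x < ∞}
    have hV' : (1 : ℝ≥0∞) / V ≠ ∞ := ENNReal.div_ne_top (by simp) hV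
    obtain ⟨t, ht⟩ := hΨ.exists_lt_map hV'
    refine absurd ((ENNReal.le_div_iff_mul_le (by simp) (by simp)).2 (le_trans ?_
      (key' f l hl hle t))) ht.not_ge
    refine mul_le_mul_right (measure_mono fun x hx => ?_) _
    have hx' : fracMaximal ρ f x = ∞ := by simpa using hx
    simp only [mem_ofPred_eq, hx']
    rw [ENNReal.top_div_of_ne_top ENNReal.coe_ne_top]
    simp
  · obtain ⟨l, hl, hle⟩ := hΦ.exists_lintegral_le_one hf.2
    have hCl : 0 < C * l := by positivity
    refine ⟨(C * l)⁻¹, by positivity, (iSup₂_le fun t _ => ?_).trans_lt ENNReal.one_lt_top⟩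
    simpa only [ENNReal.coe_inv hCl.ne', div_eq_mul_inv, mul_comm (fracMaximal ρ f _)] using
      key' f l hl hle t

theorem strongBounded_fracMaximal (hn : 1 ≤ n) {ρ : ℝ → ℝ} (hΦ : QuasiYoung D Φ)
    (hΨ : QuasiYoung E Ψ) (hρ : RhoCondition n ρ Φ Ψ) (h2 : Nabla2 Φ) :
    StrongBounded (n := n) (fracMaximal ρ) Φ Ψ := by
  obtain ⟨p, hp, k, hθ⟩ := hΦ.exists_rpow h2
  have hp0 : 0 < p := zero_lt_one.trans hp
  have hk : 0 < k := pos_iff_ne_zero.2 hθ.const_ne_zero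
  have hE : 0 < E := pos_iff_ne_zero.2 hΨ.const_ne_zero
  -- Here `2 k` is the Jensen constant of `Φ^(1/p)`, not of `Φ`.
  obtain ⟨C₁, hC₁, key⟩ := exists_map_maxFn_le hn hΦ hΨ hρ (C₀ := 2 * k) (by positivity)
  obtain ⟨Cp, hCp⟩ := exists_lintegral_maxFn_rpow_le hn hp
  set K : ℝ≥0 := max 1 Cp
  have hK1 : 1 ≤ K := le_max_left _ _
  have hK0 : 0 < K := zero_lt_one.trans_le hK1
  have hK0' : (K : ℝ≥0∞) ≠ 0 := by simpa using hK0.ne'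
  have key' : ∀ f : EuclideanSpace ℝ (Fin n) → ℂ, AEMeasurable f → ∀ l : ℝ≥0, 0 < l →
      (∫⁻ x, Φ (‖f x‖ₑ / l)) ≤ 1 →
      (∫⁻ x, Ψ (fracMaximal ρ f x / (C₁ * (E * K) * l : ℝ≥0))) ≤ 1 := by
    intro f hf l hl hle
    have hθg : AEMeasurable (fun y => Φ (‖f y‖ₑ / l) ^ p⁻¹) :=
      hθ.mono.measurable.comp_aemeasurable (hf.enorm.div_const _)
    calc ∫⁻ x, Ψ (fracMaximal ρ f x / (C₁ * (E * K) * l : ℝ≥0))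
        ≤ ∫⁻ x, (K : ℝ≥0∞)⁻¹ *
            maxFn (fun _ => 1) (fun y => Φ (‖f y‖ₑ / l) ^ p⁻¹) x ^ p := by
          refine lintegral_mono fun x => ?_
          have e : fracMaximal ρ f x / (C₁ * (E * K) * l : ℝ≥0) = ((E * K : ℝ≥0) : ℝ≥0∞)⁻¹ *
              (maxFn (fun r => ENNReal.ofReal (ρ r)) (fun y => ‖f y‖ₑ / l) x / C₁) := by
            rw [maxFn_div _ _ hl, fracMaximal_eq, div_eq_mul_inv, div_eq_mul_inv, div_eq_mul_inv,
              ENNReal.coe_mul, ENNReal.mul_inv (Or.inr ENNReal.coe_ne_top) (Or.inl ENNReal.coe_ne_top),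
              ENNReal.coe_mul C₁,
              ENNReal.mul_inv (Or.inr ENNReal.coe_ne_top) (Or.inl ENNReal.coe_ne_top)]
            ring
          rw [e]
          refine (hΨ.scale_le hK1 _).trans (mul_le_mul_right ((key _ hle x).trans ?_) _)
          have := hθ.map_maxFn_le (fun y => ‖f y‖ₑ / l) x
          rw [mul_comm, ← div_eq_mul_inv] at this
          exact (ENNReal.rpow_inv_le_iff hp0).1 this
      _ = (K : ℝ≥0∞)⁻¹ *
            ∫⁻ x, maxFn (fun _ => 1) (fun y => Φ (‖f y‖ₑ / l) ^ p⁻¹) x ^ p :=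
          lintegral_const_mul' _ _ (by simpa using hK0.ne')
      _ ≤ (K : ℝ≥0∞)⁻¹ * (K * 1) := by
          refine mul_le_mul_right ((hCp _ hθg).trans (mul_le_mul' ?_ ?_)) _
          · exact_mod_cast le_max_right _ _
          · simpa only [ENNReal.rpow_inv_rpow hp0.ne'] using hle
      _ = 1 := by rw [mul_one, ENNReal.inv_mul_cancel hK0' (by simp)]
  have hC : 0 < C₁ * (E * K) := by positivity
  refine ⟨C₁ * (E * K), hC, fun f hf => ⟨⟨(measurable_maxFn _ _).aemeasurable, ?_, ?_⟩,
    le_mul_orliczNorm hC fun l hl hle => orliczNorm_le (by positivity) (key' f hf.1 l hl hle)⟩⟩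
  · obtain ⟨l, hl, hle⟩ := hΦ.exists_lintegral_le_one hf.2
    have hm : Measurable fun x => Ψ (fracMaximal ρ f x / (C₁ * (E * K) * l : ℝ≥0)) :=
      hΨ.mono.measurable.comp ((measurable_maxFn _ _).div_const _)
    filter_upwards [ae_lt_top hm ((key' f hf.1 l hl hle).trans_lt ENNReal.one_lt_top).ne] with x hx
    by_contra hx'
    rw [not_lt, top_le_iff] at hx'
    rw [hx', ENNReal.top_div_of_ne_top ENNReal.coe_ne_top, hΨ.map_top] at hx
    exact lt_irrefl _ hx
  · obtain ⟨l, hl, hle⟩ := hΦ.exists_lintegral_le_one hf.2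
    have hCl : 0 < C₁ * (E * K) * l := by positivity
    refine ⟨(C₁ * (E * K) * l)⁻¹, by positivity, lt_of_le_of_lt ?_ ENNReal.one_lt_top⟩
    simpa only [ENNReal.coe_inv hCl.ne', div_eq_mul_inv, mul_comm (fracMaximal ρ f _)] using
      key' f hf.1 l hl hle

/-! ### Necessity of the condition on `ρ`. -/

/-- For `t ≤ r`, the ball of radius `t` centred at `(1 - t/r) x` contains `x` and lies inside
`B(0,r)`, so the indicator has average 1 on it. -/
theorem iSup_le_fracMaximal_indicator (ρ : ℝ → ℝ) {r : ℝ} {x : EuclideanSpace ℝ (Fin n)}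
    (hx : x ∈ Metric.ball 0 r) :
    ⨆ (t : ℝ) (_ : 0 < t) (_ : t ≤ r), ENNReal.ofReal (ρ t) ≤
      fracMaximal ρ ((Metric.ball (0 : EuclideanSpace ℝ (Fin n)) r).indicator fun _ => 1) x := by
  refine iSup₂_le fun t ht => iSup_le fun htr => ?_
  have hr : 0 < r := ht.trans_le htr
  have hxr : ‖x‖ < r := by simpa using hx
  have hq : 0 ≤ 1 - t / r := sub_nonneg.2 ((div_le_one hr).2 htr)
  have hxz : x ∈ Metric.ball ((1 - t / r) • x) t := by
    have e : x - (1 - t / r) • x = (t / r) • x := by module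
    rw [mem_ball_iff_norm, e, norm_smul, Real.norm_of_nonneg (by positivity), div_mul_eq_mul_div,
      div_lt_iff₀ hr]
    gcongr
  have hsub : Metric.ball ((1 - t / r) • x) t ⊆ Metric.ball 0 r := by
    refine Metric.ball_subset_ball' ?_
    rw [dist_zero_right, norm_smul, Real.norm_of_nonneg hq]
    have : (1 - t / r) * ‖x‖ ≤ (1 - t / r) * r := by gcongr
    have e : (1 - t / r) * r = r - t := by field_simp
    linarith
  have := le_maxFn (fun r => ENNReal.ofReal (ρ r))
    (fun y => ‖(Metric.ball (0 : EuclideanSpace ℝ (Fin n)) r).indicator (fun _ => (1 : ℂ)) y‖ₑ)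
    ht hxz
  rw [setLIntegral_congr_fun (g := fun _ => 1) measurableSet_ball (fun y hy => by
    simp [indicator_of_mem (hsub hy)]), setLIntegral_one,
    ENNReal.inv_mul_cancel (volume_ball_ne_zero _ ht) measure_ball_lt_top.ne, mul_one] at this
  exact this

theorem rhoCondition_of_weakBounded {ρ : ℝ → ℝ} (hΦ : QuasiYoung D Φ)
    (hΨ : QuasiYoung E Ψ) (hT : WeakBounded (n := n) (fracMaximal ρ) Φ Ψ) :
    RhoCondition n ρ Φ Ψ := by
  obtain ⟨C, hC, hT⟩ := hT
  have hD : 0 < D := pos_iff_ne_zero.2 hΦ.const_ne_zero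
  have hE : 0 < E := pos_iff_ne_zero.2 hΨ.const_ne_zero
  obtain ⟨c, hc⟩ : ∃ c : ℝ≥0, volume (Metric.ball (0 : EuclideanSpace ℝ (Fin n)) 1) = c :=
    ⟨_, (ENNReal.coe_toNNReal measure_ball_lt_top.ne).symm⟩
  have hc0 : c ≠ 0 := by
    have := volume_ball_ne_zero (0 : EuclideanSpace ℝ (Fin n)) one_pos
    rwa [hc, ENNReal.coe_ne_zero] at this
  have hc0' : (c : ℝ≥0∞) ≠ 0 := by simpa using hc0
  -- `κ` and `κ'` compare the levels `1/|B|`, natural for the test function, and `1/rⁿ`, used in the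
  -- condition.
  set κ : ℝ≥0 := max 1 c
  set κ' : ℝ≥0 := max 1 c⁻¹
  have hκ : 1 ≤ κ := le_max_left _ _
  have hκ' : 1 ≤ κ' := le_max_left _ _
  have hκ0 : 0 < κ := zero_lt_one.trans_le hκ
  have hκ0' : 0 < κ' := zero_lt_one.trans_le hκ'
  refine ⟨D * κ * (2 * C) * (E * κ'), by positivity, fun r hr => ?_⟩
  have hrn : 0 < r ^ n := pow_pos hr n
  set B := Metric.ball (0 : EuclideanSpace ℝ (Fin n)) r
  set u := ENNReal.ofReal (1 / r ^ n)
  set R := ⨆ (t : ℝ) (_ : 0 < t) (_ : t ≤ r), ENNReal.ofReal (ρ t)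
  have hV0 : volume B ≠ 0 := volume_ball_ne_zero _ hr
  have hVt : volume B ≠ ∞ := measure_ball_lt_top.ne
  have hVt' : (volume B)⁻¹ ≠ ∞ := by simpa using hV0
  have hVu : (volume B)⁻¹ = (c⁻¹ : ℝ≥0) * u := by
    rw [volume_ball_eq _ hr, hc, ENNReal.mul_inv (by simp) (by simp), ENNReal.coe_inv hc0, mul_comm,
      ← ENNReal.ofReal_inv_of_pos hrn, ← one_div (r ^ n)]
  have huV : u = c * (volume B)⁻¹ := by
    rw [hVu, ENNReal.coe_inv hc0, ← mul_assoc, ENNReal.mul_inv_cancel hc0' (by simp), one_mul]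
  have hΦu : genInv Φ u ≤ (D * κ : ℝ≥0) * genInv Φ (volume B)⁻¹ := by
    refine le_trans (hΦ.genInv_mono ?_) (hΦ.genInv_mul_le hκ hVt')
    rw [huV]
    gcongr
    exact le_max_right _ _
  have hΨu : genInv Ψ (volume B)⁻¹ ≤ (E * κ' : ℝ≥0) * genInv Ψ u := by
    refine le_trans (hΨ.genInv_mono ?_) (hΨ.genInv_mul_le hκ' (by simp [u]))
    rw [hVu]
    gcongr
    exact le_max_right _ _
  have main : R * genInv Φ (volume B)⁻¹ ≤ (2 * C : ℝ≥0) * genInv Ψ (volume B)⁻¹ := by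
    have hst := hΦ.genInv_ne_top hVt'
    have hsV := (hΦ.le_genInv_iff hVt').1 le_rfl
    generalize genInv Φ (volume B)⁻¹ = s at hst hsV
    lift s to ℝ≥0 using hst
    rcases eq_or_ne s 0 with rfl | hs0
    · simp
    have hs : 0 < s := pos_iff_ne_zero.2 hs0
    have hs0' : (s : ℝ≥0∞) ≠ 0 := by simpa using hs0
    set f : EuclideanSpace ℝ (Fin n) → ℂ := B.indicator fun _ => 1
    have hint : ∫⁻ x, Φ (s * ‖f x‖ₑ) ≤ 1 := by
      have e : ∀ x, Φ (s * ‖f x‖ₑ) = B.indicator (fun _ => Φ s) x := by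
        intro x
        by_cases hx : x ∈ B
        · simp [f, hx]
        · simp [f, hx, hΦ.map_zero]
      simp only [e]
      rw [lintegral_indicator measurableSet_ball, setLIntegral_const]
      calc Φ s * volume B ≤ (volume B)⁻¹ * volume B := by gcongr
        _ = 1 := ENNReal.inv_mul_cancel hV0 hVt
    have hfm : Measurable f := measurable_const.indicator measurableSet_ball
    have hf : InOrlicz Φ f := ⟨hfm.aemeasurable, hfm.enorm.aemeasurable,
      .of_forall fun x => by simp, s, hs, hint.trans_lt ENNReal.one_lt_top⟩
    have hN : orliczNorm Φ (fun x => ‖f x‖ₑ) ≤ (s⁻¹ : ℝ≥0) := by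
      refine orliczNorm_le (by positivity) ?_
      simpa only [ENNReal.coe_inv hs0, div_eq_mul_inv, inv_inv, mul_comm] using hint
    -- Doubling `C` makes the inequality strict, which provides an admissible `l < 2 C / s`.
    have hW : weakOrliczNorm Ψ (fracMaximal ρ f) < (2 * C * s⁻¹ : ℝ≥0) := by
      refine ((hT f hf).2.trans (mul_le_mul_right hN _)).trans_lt ?_
      rw [← ENNReal.coe_mul, ENNReal.coe_lt_coe]
      have : 0 < C * s⁻¹ := by positivity
      calc C * s⁻¹ < C * s⁻¹ + C * s⁻¹ := lt_add_of_pos_left _ this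
        _ = _ := by ring
    obtain ⟨l, hl, hle, hlt⟩ := weakOrliczNorm_lt_iff.1 hW
    have hl0 : (l : ℝ≥0∞) ≠ 0 := by simpa using hl.ne'
    -- For `τ < R / l` all of `B` lies in `{M_ρ f / l > τ}`, so the weak bound reads `Ψ(τ) |B| ≤ 1`;
    -- left continuity then reaches `R / l`.
    have hR : R / l ≤ genInv Ψ (volume B)⁻¹ := by
      rw [hΨ.le_genInv_iff hVt']
      refine hΨ.le_of_forall_lt _ _ fun τ hτ => ?_
      lift τ to ℝ≥0 using (hτ.trans_le le_top).ne
      rcases eq_or_ne τ 0 with rfl | hτ0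
      · simp [hΨ.map_zero]
      rw [← one_div, ENNReal.le_div_iff_mul_le (by simp) (by simp)]
      refine le_trans (mul_le_mul_right (measure_mono fun x hx => ?_) _)
        (hle τ (pos_iff_ne_zero.2 hτ0))
      exact hτ.trans_le (ENNReal.div_le_div_right (iSup_le_fracMaximal_indicator ρ hx) _)
    rw [ENNReal.div_le_iff hl0 (by simp)] at hR
    calc R * s ≤ genInv Ψ (volume B)⁻¹ * (2 * C * s⁻¹ : ℝ≥0) * s := by
          gcongr
          exact hR.trans (mul_le_mul_right hlt.le _)
      _ = (2 * C : ℝ≥0) * genInv Ψ (volume B)⁻¹ * ((s : ℝ≥0∞)⁻¹ * s) := by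
          rw [ENNReal.coe_mul (2 * C), ENNReal.coe_inv hs0]
          ring
      _ = _ := by rw [ENNReal.inv_mul_cancel hs0' (by simp), mul_one]
  calc R * genInv Φ u ≤ R * ((D * κ : ℝ≥0) * genInv Φ (volume B)⁻¹) := by gcongr
    _ = (D * κ : ℝ≥0) * (R * genInv Φ (volume B)⁻¹) := mul_left_comm _ _ _
    _ ≤ (D * κ : ℝ≥0) * ((2 * C : ℝ≥0) * ((E * κ' : ℝ≥0) * genInv Ψ u)) :=
        mul_le_mul_right (main.trans (mul_le_mul_right hΨu _)) _
    _ = _ := by push_cast; ring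

end OrliczMax

theorem theorem3p6 (n : ℕ) (hn : 1 ≤ n) (ρ : ℝ → ℝ) (hρ : ∀ t : ℝ, 0 < t → 0 < ρ t)
    (Φ Ψ : ℝ≥0∞ → ℝ≥0∞) (hΦ : OrliczMax.IsGenYoung Φ) (hΨ : OrliczMax.IsGenYoung Ψ) :
    (OrliczMax.RhoCondition n ρ Φ Ψ →
      (∀ C₀ : ℝ≥0, 0 < C₀ → ∃ C₁ : ℝ≥0, 0 < C₁ ∧
        ∀ f : EuclideanSpace ℝ (Fin n) → ℂ, OrliczMax.InOrlicz Φ f → ¬ (f =ᵐ[volume] 0) →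
          ∀ x : EuclideanSpace ℝ (Fin n),
            Ψ (OrliczMax.fracMaximal ρ f x /
                ((C₁ : ℝ≥0∞) * OrliczMax.orliczNorm Φ (fun y => ‖f y‖ₑ))) ≤
              Φ (OrliczMax.hlMaximal f x /
                ((C₀ : ℝ≥0∞) * OrliczMax.orliczNorm Φ (fun y => ‖f y‖ₑ)))) ∧
      OrliczMax.WeakBounded (n := n) (OrliczMax.fracMaximal ρ) Φ Ψ ∧
      (OrliczMax.Nabla2 Φ →
        OrliczMax.StrongBounded (n := n) (OrliczMax.fracMaximal ρ) Φ Ψ)) ∧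
    (OrliczMax.WeakBounded (n := n) (OrliczMax.fracMaximal ρ) Φ Ψ →
      OrliczMax.RhoCondition n ρ Φ Ψ) := by
  obtain ⟨D, hΦ⟩ := hΦ.exists_quasiYoung
  obtain ⟨E, hΨ⟩ := hΨ.exists_quasiYoung
  exact ⟨fun hR => ⟨fun C₀ hC₀ => OrliczMax.pointwise_estimate hn hΦ hΨ hR hC₀,
    OrliczMax.weakBounded_fracMaximal hn hΦ hΨ hR,
    OrliczMax.strongBounded_fracMaximal hn hΦ hΨ hR⟩,
    OrliczMax.rhoCondition_of_weakBounded hΦ hΨ⟩
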